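/- Let $q$ be a formal variable, let $\mathcal{T}=\mathbb{Z}[q^{\pm\frac12}]\langle X_1^{\pm1},X_2^{\pm1}\mid X_1X_2=qX_2X_1\rangle$ be the quantum torus, with its $\mathbb{Z}[q^{\pm\frac12}]$-basis $X^{(a,b)}=q^{-\frac12ab}X_1^aX_2^b$ ($(a,b)\in\mathbb{Z}^2$), and let $\mathcal{F}$ be its skew field of fractions. Define $X_k\in\mathcal{F}$ for all $k\in\mathbb{Z}$ recursively from $X_1,X_2$ by $$X_{k-1}X_{k+1}=\begin{cases}q^{\frac12}X_k+1,& k\text{ odd},\\ q^2X_k^4+1,& k\text{ even},\end{cases}$$ and let the quantum cluster algebra $\mathcal{A}_q(1,4)$ be the $\mathbb{Z}[q^{\pm\frac12}]$-subalgebra of $\mathcal{F}$ generated by all $X_k$, $k\in\mathbb{Z}$. Put $$X_\delta=X^{(-1,-2)}+X^{(-1,2)}+X^{(1,-2)}+(q^{-\frac12}+q^{\frac12})X^{(0,-2)},$$ let $F_0(x)=1$, $F_1(x)=x$, $F_2(x)=x^2-2$, $F_{n+1}(x)=F_n(x)x-F_{n-1}(x)$ for $n\ge2$, and let $$\mathcal{B}=\{q^{-\frac12ab}X_m^aX_{m+1}^b\mid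 m\in\mathbb{Z},\ (a,b)\in\mathbb{Z}_{\ge0}^2\}\cup\{F_n(X_\delta)\mid n\ge0\}.$$ Call $Y\in\mathcal{A}_q(1,4)$ positive if, for every $m\in\mathbb{Z}$, $Y$ is a Laurent polynomial in $X_m,X_{m+1}$, that is, a finite $\mathbb{Z}[q^{\pm\frac12}]$-linear combination of the elements $q^{-\frac12ab}X_m^aX_{m+1}^b$ ($(a,b)\in\mathbb{Z}^2$), and all coefficients of this expansion lie in $\mathbb{N}[q^{\pm\frac12}]$. Call a $\mathbb{Z}[q^{\pm\frac12}]$-basis $\mathcal{C}$ of $\mathcal{A}_q(1,4)$ the canonical basis if every positive element of $\mathcal{A}_q(1,4)$ is an $\mathbb{N}[q^{\pm\frac12}]$-linear combination of elements of $\mathcal{C}$. **Theorem.** $\mathcal{B}$ is the canonical basis of $\mathcal{A}_q(1,4)$. That is, $\mathcal{B}$ is a $\mathbb{Z}[q^{\pm\frac12}]$-basis of $\mathcal{A}_q(1,4)$, and every positive element of $\mathcal{A}_q(1,4)$ is an $\mathbb{N}[q^{\pm\frac12}]$-linear combination of elements of $\mathcal{B}$. -/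

import Mathlib

open scoped LaurentPolynomial nonZeroDivisors

noncomputable section

namespace QCluster

/-- The ring `ℤ[q^{±1/2}]`; the variable `T 1` of Mathlib's Laurent polynomials is `q^{1/2}`. -/
abbrev QRing : Type := ℤ[T;T⁻¹]

/-- `qPow r` is `q^{r/2}`. -/
def qPow (r : ℤ) : QRing := LaurentPolynomial.T r

/-- `f ∈ ℕ[q^{±1/2}]`: all coefficients of the Laurent polynomial `f` are non-negative. -/
def IsNonneg (f : QRing) : Prop := ∀ r : ℤ, 0 ≤ f.coeff r

lemma qPow_add (r s : ℤ) : qPow (r + s) = qPow r * qPow s := LaurentPolynomial.T_add r s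

lemma qPow_zero : qPow 0 = 1 := LaurentPolynomial.T_zero

lemma qPow_ne_zero (r : ℤ) : qPow r ≠ 0 := by
  intro h
  have h1 : qPow (r + -r) = 0 := by rw [qPow_add, h, zero_mul]
  rw [add_neg_cancel, qPow_zero] at h1
  exact one_ne_zero h1

/-! ### The quantum torus -/

/-- The based quantum torus: the free `ℤ[q^{±1/2}]`-module on the symbols `X^{(a,b)}`,
`(a,b) ∈ ℤ²`, with the multiplication `X^{(a,b)} X^{(c,d)} = q^{(ad-bc)/2} X^{(a+c,b+d)}`.
It is the algebra of Laurent polynomials in `X₁ = X^{(1,0)}`, `X₂ = X^{(0,1)}` subject to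
`X₁ X₂ = q X₂ X₁`, and `X^{(a,b)} = q^{-ab/2} X₁^a X₂^b`. -/
def QTorus : Type := (ℤ × ℤ) →₀ QRing

namespace QTorus

instance : AddCommGroup QTorus := inferInstanceAs (AddCommGroup ((ℤ × ℤ) →₀ QRing))

instance : Module QRing QTorus := inferInstanceAs (Module QRing ((ℤ × ℤ) →₀ QRing))

/-- The element `c X^{m}`. -/
def term (m : ℤ × ℤ) (c : QRing) : QTorus := Finsupp.single m c

/-- The basis element `X^{(a,b)}`. -/
def mono (a b : ℤ) : QTorus := term (a, b) 1

/-- The coefficient of `X^{m}`. -/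
def coeff (f : QTorus) (m : ℤ × ℤ) : QRing := (show (ℤ × ℤ) →₀ QRing from f) m

/-- The set of exponents that occur. -/
def supp (f : QTorus) : Finset (ℤ × ℤ) := (show (ℤ × ℤ) →₀ QRing from f).support

/-- The skew form: `X^{m} X^{n} = q^{ω(m,n)/2} X^{m+n}`. -/
def omega (m n : ℤ × ℤ) : ℤ := m.1 * n.2 - m.2 * n.1

instance : Mul QTorus where
  mul f g := ∑ m ∈ f.supp, ∑ n ∈ g.supp,
    term (m + n) (qPow (omega m n) * (f.coeff m * g.coeff n))

instance : One QTorus where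
  one := term 0 1

lemma one_def : (1 : QTorus) = term 0 1 := rfl

lemma mul_def (f g : QTorus) : f * g = ∑ m ∈ f.supp, ∑ n ∈ g.supp,
    term (m + n) (qPow (omega m n) * (f.coeff m * g.coeff n)) := rfl

lemma mem_supp {f : QTorus} {m : ℤ × ℤ} : m ∈ f.supp ↔ f.coeff m ≠ 0 :=
  Finsupp.mem_support_iff

@[ext] lemma ext {f g : QTorus} (h : ∀ m, f.coeff m = g.coeff m) : f = g :=
  Finsupp.ext h

@[simp] lemma coeff_zero (m : ℤ × ℤ) : (0 : QTorus).coeff m = 0 := rfl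

@[simp] lemma coeff_add (f g : QTorus) (m : ℤ × ℤ) :
    (f + g).coeff m = f.coeff m + g.coeff m := rfl

@[simp] lemma coeff_sub (f g : QTorus) (m : ℤ × ℤ) :
    (f - g).coeff m = f.coeff m - g.coeff m := rfl

@[simp] lemma coeff_smul (c : QRing) (f : QTorus) (m : ℤ × ℤ) :
    (c • f).coeff m = c * f.coeff m := rfl

lemma coeff_term (m n : ℤ × ℤ) (c : QRing) :
    (term m c).coeff n = if m = n then c else 0 := by
  classical
  exact (Finsupp.single_apply).trans (by congr)

lemma coeff_sum {ι : Type*} (s : Finset ι) (F : ι → QTorus) (m : ℤ × ℤ) :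
    (∑ i ∈ s, F i).coeff m = ∑ i ∈ s, (F i).coeff m :=
  Finsupp.finsetSum_apply s F m

lemma term_zero (m : ℤ × ℤ) : term m 0 = 0 := Finsupp.single_zero m

lemma term_add (m : ℤ × ℤ) (c d : QRing) : term m (c + d) = term m c + term m d :=
  Finsupp.single_add m c d

lemma smul_term (m : ℤ × ℤ) (c d : QRing) : c • term m d = term m (c * d) :=
  Finsupp.smul_single c m d

/-- The product may be computed over any finite sets that contain the supports. -/
lemma mul_eq_of_subset {f g : QTorus} {s t : Finset (ℤ × ℤ)} (hs : f.supp ⊆ s)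
    (ht : g.supp ⊆ t) : f * g = ∑ m ∈ s, ∑ n ∈ t,
      term (m + n) (qPow (omega m n) * (f.coeff m * g.coeff n)) := by
  have e : ∀ m, ∑ n ∈ g.supp, term (m + n) (qPow (omega m n) * (f.coeff m * g.coeff n)) =
      ∑ n ∈ t, term (m + n) (qPow (omega m n) * (f.coeff m * g.coeff n)) := by
    intro m
    refine Finset.sum_subset ht fun n _ hn => ?_
    rw [mem_supp, not_not] at hn
    rw [hn, mul_zero, mul_zero, term_zero]
  rw [mul_def, Finset.sum_congr rfl fun m _ => e m]
  refine Finset.sum_subset hs fun m _ hm => ?_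
  rw [mem_supp, not_not] at hm
  refine Finset.sum_eq_zero fun n _ => ?_
  rw [hm, zero_mul, mul_zero, term_zero]

lemma supp_add_subset (f g : QTorus) : (f + g).supp ⊆ f.supp ∪ g.supp :=
  Finsupp.support_add

protected lemma add_mul' (f g h : QTorus) : (f + g) * h = f * h + g * h := by
  rw [mul_eq_of_subset (supp_add_subset f g) (Finset.Subset.refl h.supp),
    mul_eq_of_subset (Finset.subset_union_left (s₂ := g.supp)) (Finset.Subset.refl h.supp),
    mul_eq_of_subset (Finset.subset_union_right (s₁ := f.supp)) (Finset.Subset.refl h.supp),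
    ← Finset.sum_add_distrib]
  refine Finset.sum_congr rfl fun m _ => ?_
  rw [← Finset.sum_add_distrib]
  refine Finset.sum_congr rfl fun n _ => ?_
  rw [coeff_add, add_mul, mul_add, term_add]

protected lemma mul_add' (f g h : QTorus) : f * (g + h) = f * g + f * h := by
  rw [mul_eq_of_subset (Finset.Subset.refl f.supp) (supp_add_subset g h),
    mul_eq_of_subset (Finset.Subset.refl f.supp) (Finset.subset_union_left (s₂ := h.supp)),
    mul_eq_of_subset (Finset.Subset.refl f.supp) (Finset.subset_union_right (s₁ := g.supp)),
    ← Finset.sum_add_distrib]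
  refine Finset.sum_congr rfl fun m _ => ?_
  rw [← Finset.sum_add_distrib]
  refine Finset.sum_congr rfl fun n _ => ?_
  rw [coeff_add, mul_add, mul_add, term_add]

lemma supp_term_subset (m : ℤ × ℤ) (c : QRing) : (term m c).supp ⊆ {m} :=
  Finsupp.support_single_subset

lemma term_mul_term (m n : ℤ × ℤ) (c d : QRing) :
    term m c * term n d = term (m + n) (qPow (omega m n) * (c * d)) := by
  rw [mul_eq_of_subset (supp_term_subset m c) (supp_term_subset n d)]
  simp [coeff_term]

@[elab_as_elim]
lemma induction {p : QTorus → Prop} (f : QTorus) (h0 : p 0)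
    (hadd : ∀ f g, p f → p g → p (f + g)) (ht : ∀ m c, p (term m c)) : p f :=
  Finsupp.induction_linear f h0 hadd ht

protected lemma zero_mul' (f : QTorus) : 0 * f = 0 := by
  have h := QTorus.add_mul' 0 0 f
  rw [add_zero] at h
  exact left_eq_add.mp h

protected lemma mul_zero' (f : QTorus) : f * 0 = 0 := by
  have h := QTorus.mul_add' f 0 0
  rw [add_zero] at h
  exact left_eq_add.mp h

protected lemma one_mul' (f : QTorus) : 1 * f = f := by
  induction f using QTorus.induction with
  | h0 => exact QTorus.mul_zero' 1
  | hadd f g hf hg => rw [QTorus.mul_add', hf, hg]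
  | ht m c =>
    have h : omega 0 m = 0 := by simp [omega]
    rw [one_def, term_mul_term, h, qPow_zero, zero_add, one_mul, one_mul]

protected lemma mul_one' (f : QTorus) : f * 1 = f := by
  induction f using QTorus.induction with
  | h0 => exact QTorus.zero_mul' 1
  | hadd f g hf hg => rw [QTorus.add_mul', hf, hg]
  | ht m c =>
    have h : omega m 0 = 0 := by simp [omega]
    rw [one_def, term_mul_term, h, qPow_zero, add_zero, one_mul, mul_one]

protected lemma mul_assoc' (f g h : QTorus) : f * g * h = f * (g * h) := by
  induction f using QTorus.induction with
  | h0 => simp only [QTorus.zero_mul']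
  | hadd f f' hf hf' => simp only [QTorus.add_mul', hf, hf']
  | ht m c =>
    induction g using QTorus.induction with
    | h0 => simp only [QTorus.zero_mul', QTorus.mul_zero']
    | hadd g g' hg hg' => simp only [QTorus.add_mul', QTorus.mul_add', hg, hg']
    | ht n d =>
      induction h using QTorus.induction with
      | h0 => simp only [QTorus.mul_zero']
      | hadd h h' hh hh' => simp only [QTorus.mul_add', hh, hh']
      | ht k e =>
        have key : omega (m + n) k + omega m n = omega m (n + k) + omega n k := by
          simp only [omega, Prod.fst_add, Prod.snd_add]
          ring
        have key2 : qPow (omega (m + n) k) * qPow (omega m n) =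
            qPow (omega m (n + k)) * qPow (omega n k) := by
          rw [← qPow_add, key, qPow_add]
        rw [term_mul_term, term_mul_term, term_mul_term, term_mul_term, add_assoc]
        congr 1
        linear_combination (c * d * e) * key2

instance : Ring QTorus :=
  { (inferInstance : AddCommGroup QTorus), (inferInstance : Mul QTorus),
    (inferInstance : One QTorus) with
    left_distrib := QTorus.mul_add'
    right_distrib := QTorus.add_mul'
    zero_mul := QTorus.zero_mul'
    mul_zero := QTorus.mul_zero'
    mul_assoc := QTorus.mul_assoc'
    one_mul := QTorus.one_mul'
    mul_one := QTorus.mul_one' }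

protected lemma smul_mul' (c : QRing) (f g : QTorus) : c • f * g = c • (f * g) := by
  induction f using QTorus.induction with
  | h0 => rw [smul_zero, zero_mul, smul_zero]
  | hadd f f' hf hf' => rw [smul_add, add_mul, add_mul, smul_add, hf, hf']
  | ht m d =>
    induction g using QTorus.induction with
    | h0 => rw [mul_zero, mul_zero, smul_zero]
    | hadd g g' hg hg' => rw [mul_add, mul_add, smul_add, hg, hg']
    | ht n e =>
      rw [smul_term, term_mul_term, term_mul_term, smul_term]
      congr 1
      ring

protected lemma mul_smul' (c : QRing) (f g : QTorus) : f * c • g = c • (f * g) := by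
  induction f using QTorus.induction with
  | h0 => rw [zero_mul, zero_mul, smul_zero]
  | hadd f f' hf hf' => rw [add_mul, add_mul, smul_add, hf, hf']
  | ht m d =>
    induction g using QTorus.induction with
    | h0 => rw [smul_zero, mul_zero, smul_zero]
    | hadd g g' hg hg' => rw [smul_add, mul_add, mul_add, smul_add, hg, hg']
    | ht n e =>
      rw [smul_term, term_mul_term, term_mul_term, smul_term]
      congr 1
      ring

instance : Algebra QRing QTorus := Algebra.ofModule QTorus.smul_mul' QTorus.mul_smul'

/-- Sanity check: the defining relation `X₁ X₂ = q X₂ X₁`. -/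
lemma mono_commutation : mono 1 0 * mono 0 1 = qPow 2 • (mono 0 1 * mono 1 0) := by
  rw [mono, mono, term_mul_term, term_mul_term, smul_term]
  have h : omega ((1 : ℤ), (0 : ℤ)) (0, 1) = 2 + omega ((0 : ℤ), (1 : ℤ)) (1, 0) := by
    simp [omega]
  rw [h, qPow_add, add_comm ((1 : ℤ), (0 : ℤ)), mul_assoc]

/-! ### The quantum torus is an Ore domain -/

lemma coeff_mul (f g : QTorus) (k : ℤ × ℤ) : (f * g).coeff k = ∑ m ∈ f.supp, ∑ n ∈ g.supp,
    if m + n = k then qPow (omega m n) * (f.coeff m * g.coeff n) else 0 := by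
  rw [mul_def, coeff_sum]
  refine Finset.sum_congr rfl fun m _ => ?_
  rw [coeff_sum]
  exact Finset.sum_congr rfl fun n _ => coeff_term _ _ _

lemma exists_of_mem_supp_mul {f g : QTorus} {k : ℤ × ℤ} (hk : k ∈ (f * g).supp) :
    ∃ m ∈ f.supp, ∃ n ∈ g.supp, m + n = k := by
  rw [mem_supp, coeff_mul] at hk
  obtain ⟨m, hm, h1⟩ := Finset.exists_ne_zero_of_sum_ne_zero hk
  obtain ⟨n, hn, h2⟩ := Finset.exists_ne_zero_of_sum_ne_zero h1
  refine ⟨m, hm, n, hn, ?_⟩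
  by_contra h
  exact h2 (if_neg h)

lemma supp_nonempty {f : QTorus} (hf : f ≠ 0) : f.supp.Nonempty :=
  Finsupp.support_nonempty_iff.mpr hf

instance : Nontrivial QTorus := by
  refine ⟨0, 1, fun h => ?_⟩
  have h1 : (0 : QTorus).coeff 0 = (1 : QTorus).coeff 0 := by rw [← h]
  rw [one_def, coeff_term, if_pos rfl, coeff_zero] at h1
  exact zero_ne_one h1

instance : NoZeroDivisors QTorus where
  eq_zero_or_eq_zero_of_mul_eq_zero := by
    intro f g hfg
    by_contra! hne
    obtain ⟨m, hm, n, hn, hu⟩ := UniqueSums.uniqueAdd_of_nonempty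
      (supp_nonempty hne.1) (supp_nonempty hne.2)
    have h0 : (f * g).coeff (m + n) = 0 := by rw [hfg, coeff_zero]
    rw [coeff_mul, Finset.sum_eq_single_of_mem m hm, Finset.sum_eq_single_of_mem n hn,
      if_pos rfl] at h0
    · exact mul_ne_zero (qPow_ne_zero _) (mul_ne_zero (mem_supp.mp hm) (mem_supp.mp hn)) h0
    · intro n' hn' h
      exact if_neg fun he => h (hu hm hn' he).2
    · intro m' hm' h
      refine Finset.sum_eq_zero fun n' hn' => if_neg fun he => h (hu hm' hn' he).1

/-- The box `[-N, N]²` of exponents. -/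
def box (N : ℕ) : Finset (ℤ × ℤ) :=
  Finset.Icc (-(N : ℤ)) N ×ˢ Finset.Icc (-(N : ℤ)) N

lemma mem_box {N : ℕ} {m : ℤ × ℤ} :
    m ∈ box N ↔ (-(N : ℤ) ≤ m.1 ∧ m.1 ≤ N) ∧ (-(N : ℤ) ≤ m.2 ∧ m.2 ≤ N) := by
  simp [box]

lemma card_box (N : ℕ) : (box N).card = (2 * N + 1) * (2 * N + 1) := by
  have h : ((N : ℤ) + 1 - -(N : ℤ)).toNat = 2 * N + 1 := by omega
  rw [box, Finset.card_product, Int.card_Icc, h]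

lemma exists_supp_subset_box (f : QTorus) : ∃ N, f.supp ⊆ box N := by
  refine ⟨∑ m ∈ f.supp, (m.1.natAbs + m.2.natAbs), fun m hm => ?_⟩
  have h := Finset.single_le_sum (f := fun m : ℤ × ℤ => m.1.natAbs + m.2.natAbs)
    (fun _ _ => Nat.zero_le _) hm
  rw [mem_box]
  omega

lemma box_mono {M N : ℕ} (h : M ≤ N) : box M ⊆ box N := by
  intro m hm
  rw [mem_box] at *
  omega

lemma supp_mul_subset_box {f g : QTorus} {M N : ℕ} (hf : f.supp ⊆ box M)
    (hg : g.supp ⊆ box N) : (f * g).supp ⊆ box (M + N) := by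
  intro k hk
  obtain ⟨m, hm, n, hn, rfl⟩ := exists_of_mem_supp_mul hk
  have h1 := mem_box.mp (hf hm)
  have h2 := mem_box.mp (hg hn)
  rw [mem_box, Prod.fst_add, Prod.snd_add]
  push_cast
  omega

/-- The element with prescribed coefficients on a box. -/
def ofBox (N : ℕ) : (box N → QRing) →ₗ[QRing] QTorus where
  toFun u := ∑ m, term m.1 (u m)
  map_add' u v := by
    rw [← Finset.sum_add_distrib]
    exact Finset.sum_congr rfl fun m _ => term_add _ _ _
  map_smul' c u := by
    rw [RingHom.id_apply, Finset.smul_sum]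
    exact Finset.sum_congr rfl fun m _ => (smul_term _ _ _).symm

lemma coeff_ofBox {N : ℕ} (u : box N → QRing) (m : box N) : (ofBox N u).coeff m.1 = u m := by
  rw [ofBox, LinearMap.coe_mk, AddHom.coe_mk, coeff_sum,
    Finset.sum_eq_single_of_mem m (Finset.mem_univ m), coeff_term, if_pos rfl]
  intro n _ hn
  rw [coeff_term, if_neg fun h => hn (Subtype.ext h)]

lemma supp_ofBox {N : ℕ} (u : box N → QRing) : (ofBox N u).supp ⊆ box N := by
  intro k hk
  by_contra h
  refine mem_supp.mp hk ?_
  rw [ofBox, LinearMap.coe_mk, AddHom.coe_mk, coeff_sum]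
  refine Finset.sum_eq_zero fun m _ => ?_
  rw [coeff_term, if_neg]
  rintro rfl
  exact h m.2

/-- The left Ore condition, by counting dimensions on large boxes. -/
lemma ore_condition (r s : QTorus) (hs : s ≠ 0) :
    ∃ r' s' : QTorus, s' ≠ 0 ∧ s' * r = r' * s := by
  obtain ⟨d₁, h₁⟩ := exists_supp_subset_box r
  obtain ⟨d₂, h₂⟩ := exists_supp_subset_box s
  set d := max d₁ d₂ with hd
  have hr : r.supp ⊆ box d := h₁.trans (box_mono (le_max_left _ _))
  have hs' : s.supp ⊆ box d := h₂.trans (box_mono (le_max_right _ _))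
  set N := 3 * d + 1 with hN
  let φ : (box N ⊕ box N → QRing) →ₗ[QRing] (box (N + d) → QRing) :=
    { toFun := fun w k => (ofBox N (w ∘ Sum.inl) * r - ofBox N (w ∘ Sum.inr) * s).coeff k.1
      map_add' := by
        intro w w'
        funext k
        have e1 : (w + w') ∘ Sum.inl = (w ∘ Sum.inl + w' ∘ Sum.inl : box N → QRing) := rfl
        have e2 : (w + w') ∘ Sum.inr = (w ∘ Sum.inr + w' ∘ Sum.inr : box N → QRing) := rfl
        rw [e1, e2, map_add, map_add, add_mul, add_mul, Pi.add_apply]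
        simp only [coeff_add, coeff_sub]
        ring
      map_smul' := by
        intro c w
        funext k
        have e1 : (c • w) ∘ Sum.inl = (c • (w ∘ Sum.inl) : box N → QRing) := rfl
        have e2 : (c • w) ∘ Sum.inr = (c • (w ∘ Sum.inr) : box N → QRing) := rfl
        rw [e1, e2, map_smul, map_smul, smul_mul_assoc, smul_mul_assoc, RingHom.id_apply,
          Pi.smul_apply, smul_eq_mul]
        simp only [coeff_smul, coeff_sub]
        ring }
  have hφ : ¬ Function.Injective φ := by
    intro hinj
    have hc := card_le_of_injective QRing φ hinj
    rw [Fintype.card_sum, Fintype.card_coe, Fintype.card_coe, card_box, card_box] at hc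
    rw [hN] at hc
    nlinarith
  rw [injective_iff_map_eq_zero] at hφ
  push Not at hφ
  obtain ⟨w, hw, hw0⟩ := hφ
  have hz : ofBox N (w ∘ Sum.inl) * r = ofBox N (w ∘ Sum.inr) * s := by
    refine QTorus.ext fun k => ?_
    by_cases hk : k ∈ box (N + d)
    · have h := congrFun hw ⟨k, hk⟩
      exact sub_eq_zero.mp h
    · have e1 : (ofBox N (w ∘ Sum.inl) * r).coeff k = 0 := by
        by_contra h
        exact hk (supp_mul_subset_box (supp_ofBox _) hr (mem_supp.mpr h))
      have e2 : (ofBox N (w ∘ Sum.inr) * s).coeff k = 0 := by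
        by_contra h
        exact hk (supp_mul_subset_box (supp_ofBox _) hs' (mem_supp.mpr h))
      rw [e1, e2]
  refine ⟨ofBox N (w ∘ Sum.inr), ofBox N (w ∘ Sum.inl), fun h0 => hw0 ?_, hz⟩
  rw [h0, zero_mul] at hz
  have h1 : ofBox N (w ∘ Sum.inr) = 0 := (mul_eq_zero.mp hz.symm).resolve_right hs
  funext i
  rcases i with i | i
  · have := coeff_ofBox (w ∘ Sum.inl) i
    rw [h0, coeff_zero] at this
    exact this.symm
  · have := coeff_ofBox (w ∘ Sum.inr) i
    rw [h1, coeff_zero] at this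
    exact this.symm

instance : OreLocalization.OreSet QTorus⁰ :=
  Classical.choice <| OreLocalization.nonempty_oreSet_iff_of_noZeroDivisors.mpr fun r s => by
    obtain ⟨r', s', h0, h⟩ := ore_condition r s.1 (nonZeroDivisors.ne_zero s.2)
    exact ⟨r', ⟨s', mem_nonZeroDivisors_of_ne_zero h0⟩, h⟩

end QTorus

/-! ### The skew field of fractions and the cluster variables -/

/-- The skew field of fractions of the quantum torus. -/
abbrev QFrac : Type := OreLocalization QTorus⁰ QTorus

/-- The embedding of the quantum torus into its skew field of fractions. -/
def toFrac : QTorus →+* QFrac := OreLocalization.numeratorRingHom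

/-- The right-hand side of the exchange relation at `k`, as a function of `x = X_k`:
`q^{1/2} x + 1` for `k` odd and `q² x⁴ + 1` for `k` even. -/
def exchange (k : ℤ) (x : QFrac) : QFrac :=
  if Odd k then qPow 1 • x + 1 else qPow 4 • x ^ 4 + 1

/-- `clusterUp n = (X_{n+1}, X_{n+2})`, computed from `X_{k+1} = X_{k-1}⁻¹ (exchange k X_k)`. -/
def clusterUp : ℕ → QFrac × QFrac
  | 0 => (toFrac (QTorus.mono 1 0), toFrac (QTorus.mono 0 1))
  | n + 1 => ((clusterUp n).2, (clusterUp n).1⁻¹ * exchange (n + 2) (clusterUp n).2)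

/-- `clusterDown n = (X_{1-n}, X_{2-n})`, computed from
`X_{k-1} = (exchange k X_k) X_{k+1}⁻¹`. -/
def clusterDown : ℕ → QFrac × QFrac
  | 0 => (toFrac (QTorus.mono 1 0), toFrac (QTorus.mono 0 1))
  | n + 1 => (exchange (1 - n) (clusterDown n).1 * (clusterDown n).2⁻¹, (clusterDown n).1)

/-- The cluster variables `X_k`, `k ∈ ℤ`: the sequence in the skew field of fractions with
`X_1 = X^{(1,0)}`, `X_2 = X^{(0,1)}` and `X_{k-1} X_{k+1} = exchange k X_k` for all `k`. -/
def clusterVar (k : ℤ) : QFrac :=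
  if 1 ≤ k then (clusterUp (k - 1).toNat).1 else (clusterDown (1 - k).toNat).1

/-! ### The cluster variables are non-zero and satisfy the exchange relations -/

lemma toFrac_injective : Function.Injective toFrac :=
  OreLocalization.numeratorHom_inj fun _ hx => hx.1

lemma smul_eq_zero_imp {c : QRing} {x : QFrac} (h : c • x = 0) (hx : x ≠ 0) : c = 0 := by
  have h1 : toFrac (algebraMap QRing QTorus c) = 0 := by
    rw [Algebra.smul_def] at h
    exact (mul_eq_zero.mp h).resolve_right hx
  have h2 : algebraMap QRing QTorus c = 0 := toFrac_injective (h1.trans (map_zero _).symm)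
  rw [Algebra.algebraMap_eq_smul_one] at h2
  have h3 := congrArg (fun f => QTorus.coeff f 0) h2
  simpa [QTorus.one_def, QTorus.coeff_term] using h3

lemma toFrac_smul (c : QRing) (f : QTorus) : toFrac (c • f) = c • toFrac f := by
  rw [Algebra.smul_def, Algebra.smul_def, map_mul]
  rfl

lemma qPow_ne_one {r : ℤ} (hr : r ≠ 0) : qPow r ≠ 1 := by
  intro h
  have h1 : (AddMonoidAlgebra.single r 1 : QRing) = AddMonoidAlgebra.single 0 1 :=
    h.trans qPow_zero.symm
  have h2 := congrArg (fun f : QRing => f.coeff 0) h1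
  rw [AddMonoidAlgebra.coeff_single, AddMonoidAlgebra.coeff_single] at h2
  rw [Finsupp.single_apply, Finsupp.single_apply, if_neg hr, if_pos rfl] at h2
  exact zero_ne_one h2

/-- `x y = q y x` with `x`, `y` non-zero. -/
def QCommute (x y : QFrac) : Prop := x ≠ 0 ∧ y ≠ 0 ∧ x * y = qPow 2 • (y * x)

lemma QCommute.pow_right {x y : QFrac} (h : QCommute x y) (j : ℕ) :
    x * y ^ j = qPow (2 * j) • (y ^ j * x) := by
  induction j with
  | zero => simp [qPow_zero]
  | succ j ih =>
    have e : (2 * ((j + 1 : ℕ) : ℤ)) = 2 * j + 2 := by push_cast; ring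
    rw [pow_succ, ← mul_assoc, ih, smul_mul_assoc, mul_assoc, h.2.2, mul_smul_comm, smul_smul,
      mul_assoc, e, qPow_add]

lemma QCommute.pow_left {x y : QFrac} (h : QCommute x y) (j : ℕ) :
    x ^ j * y = qPow (2 * j) • (y * x ^ j) := by
  induction j with
  | zero => simp [qPow_zero]
  | succ j ih =>
    have e : (2 * ((j + 1 : ℕ) : ℤ)) = 2 + 2 * j := by push_cast; ring
    rw [pow_succ, mul_assoc, h.2.2, mul_smul_comm, ← mul_assoc, ih, smul_mul_assoc, smul_smul,
      mul_assoc, e, qPow_add]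

lemma smul_pow_add_one_ne_zero {x y : QFrac} (hx : x ≠ 0) (hy : y ≠ 0) {j : ℕ} {r s : ℤ}
    (hs : s ≠ 0) (h : x * y ^ j = qPow s • (y ^ j * x)) : qPow r • y ^ j + 1 ≠ 0 := by
  intro h0
  have h1 : qPow r • y ^ j = -1 := eq_neg_of_add_eq_zero_left h0
  have h2 : x * (qPow r • y ^ j) = (qPow r • y ^ j) * x := by rw [h1]; simp
  rw [mul_smul_comm, smul_mul_assoc, h, smul_smul, ← sub_eq_zero, ← sub_smul] at h2
  have h3 := smul_eq_zero_imp h2 (mul_ne_zero (pow_ne_zero j hy) hx)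
  have h4 : qPow r * (qPow s - 1) = 0 := by rw [← h3]; ring
  rcases mul_eq_zero.mp h4 with h5 | h5
  · exact qPow_ne_zero r h5
  · exact qPow_ne_one hs (sub_eq_zero.mp h5)

lemma exchange_ne_zero_right {x y : QFrac} (h : QCommute x y) (k : ℤ) : exchange k y ≠ 0 := by
  rw [exchange]
  split_ifs
  · have := smul_pow_add_one_ne_zero (r := 1) h.1 h.2.1 (j := 1) (by norm_num) (h.pow_right 1)
    rwa [pow_one] at this
  · exact smul_pow_add_one_ne_zero h.1 h.2.1 (by norm_num) (h.pow_right 4)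

lemma exchange_ne_zero_left {x y : QFrac} (h : QCommute x y) (k : ℤ) : exchange k x ≠ 0 := by
  have key : ∀ j : ℕ, y * x ^ j = qPow (-(2 * j)) • (x ^ j * y) := by
    intro j
    rw [h.pow_left, smul_smul, ← qPow_add, neg_add_cancel, qPow_zero, one_smul]
  rw [exchange]
  split_ifs
  · have := smul_pow_add_one_ne_zero (r := 1) h.2.1 h.1 (j := 1) (by norm_num) (key 1)
    rwa [pow_one] at this
  · exact smul_pow_add_one_ne_zero h.2.1 h.1 (by norm_num) (key 4)

lemma exchange_commute (k : ℤ) (x : QFrac) : x * exchange k x = exchange k x * x := by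
  rw [exchange]
  split_ifs
  · rw [mul_add, add_mul, mul_smul_comm, smul_mul_assoc, mul_one, one_mul]
  · rw [mul_add, add_mul, mul_smul_comm, smul_mul_assoc, mul_one, one_mul, ← pow_succ,
      ← pow_succ']

lemma QCommute.up {x y : QFrac} (h : QCommute x y) (k : ℤ) :
    QCommute y (x⁻¹ * exchange k y) := by
  refine ⟨h.2.1, mul_ne_zero (inv_ne_zero h.1) (exchange_ne_zero_right h k), ?_⟩
  have e : y * x⁻¹ = qPow 2 • (x⁻¹ * y) := by
    calc y * x⁻¹ = x⁻¹ * (x * y) * x⁻¹ := by rw [inv_mul_cancel_left₀ h.1]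
      _ = qPow 2 • (x⁻¹ * y * (x * x⁻¹)) := by
        rw [h.2.2, mul_smul_comm, smul_mul_assoc]; simp only [mul_assoc]
      _ = _ := by rw [mul_inv_cancel₀ h.1, mul_one]
  rw [← mul_assoc, e, smul_mul_assoc, mul_assoc, exchange_commute, mul_assoc]

lemma QCommute.down {x y : QFrac} (h : QCommute x y) (k : ℤ) :
    QCommute (exchange k x * y⁻¹) x := by
  refine ⟨mul_ne_zero (exchange_ne_zero_left h k) (inv_ne_zero h.2.1), h.1, ?_⟩
  have e : y⁻¹ * x = qPow 2 • (x * y⁻¹) := by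
    calc y⁻¹ * x = y⁻¹ * (x * y) * y⁻¹ := by
          rw [mul_assoc, mul_assoc, mul_inv_cancel₀ h.2.1, mul_one]
      _ = qPow 2 • ((y⁻¹ * y) * (x * y⁻¹)) := by
        rw [h.2.2, mul_smul_comm, smul_mul_assoc]; simp only [mul_assoc]
      _ = _ := by rw [inv_mul_cancel₀ h.2.1, one_mul]
  rw [mul_assoc, e, mul_smul_comm, ← mul_assoc, ← exchange_commute, mul_assoc]

lemma qCommute_initial :
    QCommute (toFrac (QTorus.mono 1 0)) (toFrac (QTorus.mono 0 1)) := by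
  have hne : ∀ a b, toFrac (QTorus.mono a b) ≠ 0 := by
    intro a b h
    have h1 : QTorus.mono a b = 0 := toFrac_injective (h.trans (map_zero _).symm)
    have h2 := congrArg (fun f => QTorus.coeff f (a, b)) h1
    simp [QTorus.mono, QTorus.coeff_term] at h2
  refine ⟨hne _ _, hne _ _, ?_⟩
  rw [← map_mul, ← map_mul, ← toFrac_smul, QTorus.mono_commutation]

lemma qCommute_clusterUp (n : ℕ) : QCommute (clusterUp n).1 (clusterUp n).2 := by
  induction n with
  | zero => exact qCommute_initial
  | succ n ih => exact ih.up _

lemma qCommute_clusterDown (n : ℕ) : QCommute (clusterDown n).1 (clusterDown n).2 := by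
  induction n with
  | zero => exact qCommute_initial
  | succ n ih => exact ih.down _

lemma clusterVar_up (n : ℕ) : clusterVar (n + 1) = (clusterUp n).1 := by
  rw [clusterVar, if_pos (by omega)]
  congr 2
  omega

lemma clusterVar_down (n : ℕ) : clusterVar (1 - n) = (clusterDown n).1 := by
  rcases n with _ | n
  · exact clusterVar_up 0
  · rw [clusterVar, if_neg (by omega)]
    congr 2
    omega

lemma clusterVar_one : clusterVar 1 = toFrac (QTorus.mono 1 0) := clusterVar_up 0

lemma clusterVar_two : clusterVar 2 = toFrac (QTorus.mono 0 1) := clusterVar_up 1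

lemma clusterVar_ne_zero (k : ℤ) : clusterVar k ≠ 0 := by
  rw [clusterVar]
  split_ifs
  · exact (qCommute_clusterUp _).1
  · exact (qCommute_clusterDown _).1

/-- The exchange relations `X_{k-1} X_{k+1} = q^{1/2} X_k + 1` (`k` odd) and
`X_{k-1} X_{k+1} = q² X_k⁴ + 1` (`k` even). -/
lemma clusterVar_exchange (k : ℤ) :
    clusterVar (k - 1) * clusterVar (k + 1) = exchange k (clusterVar k) := by
  rcases le_or_gt 2 k with hk | hk
  · obtain ⟨n, rfl⟩ : ∃ n : ℕ, k = n + 2 := ⟨(k - 2).toNat, by omega⟩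
    have e1 : clusterVar ((n : ℤ) + 2 - 1) = (clusterUp n).1 := by
      rw [← clusterVar_up]; congr 1; ring
    have e2 : clusterVar ((n : ℤ) + 2) = (clusterUp n).2 := by
      have := clusterVar_up (n + 1)
      rw [show (((n + 1 : ℕ) : ℤ) + 1) = (n : ℤ) + 2 by push_cast; ring] at this
      exact this
    have e3 : clusterVar ((n : ℤ) + 2 + 1) = (clusterUp n).1⁻¹ * exchange (n + 2) (clusterUp n).2 := by
      have := clusterVar_up (n + 2)
      rw [show (((n + 2 : ℕ) : ℤ) + 1) = (n : ℤ) + 2 + 1 by push_cast; ring] at this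
      exact this
    rw [e1, e2, e3, mul_inv_cancel_left₀ (qCommute_clusterUp n).1]
  · obtain ⟨n, rfl⟩ : ∃ n : ℕ, k = 1 - n := ⟨(1 - k).toNat, by omega⟩
    have e1 : clusterVar ((1 : ℤ) - n) = (clusterDown n).1 := clusterVar_down n
    have e2 : clusterVar ((1 : ℤ) - n + 1) = (clusterDown n).2 := by
      rcases n with _ | n
      · exact clusterVar_two
      · have := clusterVar_down n
        rw [show (1 : ℤ) - n = 1 - ((n + 1 : ℕ) : ℤ) + 1 by push_cast; ring] at this
        exact this
    have e3 : clusterVar ((1 : ℤ) - n - 1) =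
        exchange (1 - n) (clusterDown n).1 * (clusterDown n).2⁻¹ := by
      have := clusterVar_down (n + 1)
      rw [show (1 : ℤ) - ((n + 1 : ℕ) : ℤ) = 1 - n - 1 by push_cast; ring] at this
      exact this
    rw [e1, e2, e3, inv_mul_cancel_right₀ (qCommute_clusterDown n).2.1]

/-! ### The cluster algebra and the basis -/

/-- The quantum cluster algebra `A_q(1,4)`: the `ℤ[q^{±1/2}]`-subalgebra of the skew field of
fractions generated by all cluster variables. -/
def clusterAlgebra : Subalgebra QRing QFrac :=
  Algebra.adjoin QRing (Set.range clusterVar)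

/-- The Laurent monomial `q^{-ab/2} X_m^a X_{m+1}^b` in the cluster `{X_m, X_{m+1}}`. -/
def clusterMono (m a b : ℤ) : QFrac :=
  qPow (-(a * b)) • (clusterVar m ^ a * clusterVar (m + 1) ^ b)

/-- The element `X_δ = X^{(-1,-2)} + X^{(-1,2)} + X^{(1,-2)} + (q^{-1/2}+q^{1/2}) X^{(0,-2)}`. -/
def Xdelta : QFrac :=
  toFrac (QTorus.mono (-1) (-2) + QTorus.mono (-1) 2 + QTorus.mono 1 (-2)
    + (qPow (-1) + qPow 1) • QTorus.mono 0 (-2))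

/-- The Chebyshev polynomials `F_0 = 1`, `F_1 = x`, `F_2 = x² - 2`,
`F_{n+1} = F_n x - F_{n-1}` for `n ≥ 2`. -/
def chebF : ℕ → Polynomial ℤ
  | 0 => 1
  | 1 => Polynomial.X
  | 2 => Polynomial.X ^ 2 - 2
  | n + 3 => chebF (n + 2) * Polynomial.X - chebF (n + 1)

/-- The set `𝓑` of all cluster monomials `q^{-ab/2} X_m^a X_{m+1}^b` (`m ∈ ℤ`, `a, b ≥ 0`)
and all `F_n(X_δ)` (`n ≥ 0`). -/
def basisB : Set QFrac :=
  {Z | ∃ (m : ℤ) (a b : ℕ), Z = clusterMono m a b} ∪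
    {Z | ∃ n : ℕ, Z = Polynomial.aeval Xdelta (chebF n)}

/-- `Y` is an element of `A_q(1,4)` whose Laurent expansion in every cluster `{X_m, X_{m+1}}`
has all its coefficients in `ℕ[q^{±1/2}]`. -/
def IsPositive (Y : QFrac) : Prop :=
  Y ∈ clusterAlgebra ∧ ∀ m : ℤ, ∃ c : ℤ × ℤ →₀ QRing,
    (∀ e, IsNonneg (c e)) ∧ Y = c.sum fun e r => r • clusterMono m e.1 e.2

/-- `C` is a `ℤ[q^{±1/2}]`-basis of `A_q(1,4)`. -/
def IsBasisOfClusterAlgebra (C : Set QFrac) : Prop :=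
  LinearIndependent QRing (Subtype.val : C → QFrac) ∧
    Submodule.span QRing C = Subalgebra.toSubmodule clusterAlgebra

/-- `C` is the canonical basis of `A_q(1,4)`: it is a `ℤ[q^{±1/2}]`-basis, and every positive
element is an `ℕ[q^{±1/2}]`-linear combination of elements of `C`. -/
def IsCanonicalBasis (C : Set QFrac) : Prop :=
  IsBasisOfClusterAlgebra C ∧ ∀ Y : QFrac, IsPositive Y →
    ∃ c : C →₀ QRing, (∀ Z, IsNonneg (c Z)) ∧ Y = c.sum fun Z r => r • (Z : QFrac)

end QCluster

end

noncomputable section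

namespace QCluster

/-! ### Elements commuting up to a power of `q` -/

section DivisionRing

variable {R : Type*} [DivisionRing R] [Algebra QRing R]

/-! The key fact is that every coefficient with respect to `basisB` is also a coefficient of a
Laurent expansion in a well-chosen cluster (`exists_coeff_eq`). Linear independence and positivity
follow together: the zero element has zero expansion, and a positive element has expansions with
coefficients in `ℕ[q^{±1/2}]`. Expansions are unique by `torus_algHom_injective`.

Such a coefficient is isolated as follows. In the cluster `{X_m, X_{m+1}}` no basis element has an
exponent in the closed first quadrant, except the monomials of that cluster themselves
(`exists_clusterHom_quadrantFree`). So the coefficient at `(a, b)` with `a, b ≥ 0` belongs to one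
cluster monomial. For `n ≥ 1` the element `F_n(X_δ)` has, in every odd cluster, the extremal
exponent `(n, -2n)` with coefficient `1`. The other `F_j(X_δ)` miss it, and so does any given
cluster monomial once the expansion is taken in an odd cluster sufficiently far to its left
(`exists_coeff_ray`).

Both facts rest on bounds for the exponents of cluster variables. The element `X_δ` gives the even
variables a linear recursion, `X_δ X_k = q^{-1/2} X_{k+2} + q^{1/2} X_{k-2}`, which controls their
extremal exponents (`exists_shape`); odd variables come from products of two even ones. For each
cluster this yields a linear form that is non-negative on the first quadrant and negative on all
exponents of both variables (for the clusters next to the initial one, of one of them).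

For spanning, the span of `basisB` is shown to be a left ideal of the cluster algebra: it is stable
under `X_δ`, then under even variables by the same recursion, then under odd ones by the exchange
relation (`span_basisB`).

All relations are stated for a sequence in an arbitrary division ring. Shifts by even numbers, and
reversal of the index in the opposite ring, then reduce every cluster to `{x 1, x 2}`. -/

lemma qPow_smul_qPow_smul (r s : ℤ) (x : R) : qPow r • qPow s • x = qPow (r + s) • x := by
  rw [smul_smul, qPow_add]

lemma qPow_zero_smul (x : R) : qPow 0 • x = x := by rw [qPow_zero, one_smul]

lemma eq_qPow_smul_iff {r : ℤ} {x y : R} : x = qPow r • y ↔ y = qPow (-r) • x := by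
  constructor
  · rintro rfl
    rw [qPow_smul_qPow_smul, neg_add_cancel, qPow_zero_smul]
  · rintro rfl
    rw [qPow_smul_qPow_smul, add_neg_cancel, qPow_zero_smul]

lemma qPow_smul_zpow (r n : ℤ) (x : R) : (qPow r • x) ^ n = qPow (r * n) • x ^ n := by
  have hc : ∀ m : ℕ, (algebraMap QRing R (qPow r)) ^ m = algebraMap QRing R (qPow (r * m)) := by
    intro m
    rw [← map_pow, qPow, qPow, LaurentPolynomial.T_pow, mul_comm]
  have hu : ∀ s : ℤ, (algebraMap QRing R (qPow s))⁻¹ = algebraMap QRing R (qPow (-s)) := by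
    intro s
    refine (eq_inv_of_mul_eq_one_left ?_).symm
    rw [← map_mul, ← qPow_add, neg_add_cancel, qPow_zero, map_one]
  rw [Algebra.smul_def, Commute.mul_zpow (Algebra.commutes (A := R) (qPow r) x : Commute _ _), Algebra.smul_def]
  congr 1
  obtain ⟨m, rfl | rfl⟩ := n.eq_nat_or_neg
  · rw [zpow_natCast, hc]
  · rw [zpow_neg, zpow_natCast, hc, hu, mul_neg]

lemma qComm_symm {x y : R} {r : ℤ} (h : x * y = qPow r • (y * x)) :
    y * x = qPow (-r) • (x * y) := eq_qPow_smul_iff.mp h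

lemma qComm_zpow_right {x y : R} {r : ℤ} (h : x * y = qPow r • (y * x)) (n : ℤ) :
    x * y ^ n = qPow (r * n) • (y ^ n * x) := by
  have h1 : SemiconjBy x y (qPow r • y) := by rw [SemiconjBy, h, smul_mul_assoc]
  have h2 := h1.zpow_right₀ n
  rwa [qPow_smul_zpow, SemiconjBy, smul_mul_assoc] at h2

lemma qComm_zpow {x y : R} {r : ℤ} (h : x * y = qPow r • (y * x))
    (m n : ℤ) : x ^ m * y ^ n = qPow (r * m * n) • (y ^ n * x ^ m) := by
  have h1 := qComm_zpow_right h n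
  have h2 := qComm_zpow_right (qComm_symm h1) m
  rw [qComm_symm h2]
  congr 2
  ring

lemma qComm_pow_right {x y : R} {r : ℤ} (h : x * y = qPow r • (y * x)) (n : ℕ) :
    x * y ^ n = qPow (r * n) • (y ^ n * x) := by
  have := qComm_zpow_right h n
  rwa [zpow_natCast] at this

/-! ### Abstract cluster sequences -/

/-- A sequence of non-zero elements with the commutation and exchange relations of the cluster
variables of `A_q(1,4)`. -/
structure IsExchangeSeq (x : ℤ → R) : Prop where
  ne_zero : ∀ k, x k ≠ 0
  comm : ∀ k, x k * x (k + 1) = qPow 2 • (x (k + 1) * x k)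
  exch_odd : ∀ k, Odd k → x (k - 1) * x (k + 1) = qPow 1 • x k + 1
  exch_even : ∀ k, Even k → x (k - 1) * x (k + 1) = qPow 4 • x k ^ 4 + 1

/-- An exchange sequence with an element `d` that satisfies the relations of `X_δ`. -/
structure IsClusterSeq (x : ℤ → R) (d : R) : Prop extends IsExchangeSeq x where
  delta : ∀ k, Even k → x k * d * x k = x (k + 1) + x (k - 1) + (qPow 1 • 1 + qPow (-1) • 1)

/-! ### Relations between consecutive cluster variables and `d`. -/

lemma exch_odd_swap {x y z : R} (hx : x ≠ 0) (h : x * y = qPow 2 • (y * x))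
    (hz : x * z = qPow 1 • y + 1) : z * x = qPow (-1) • y + 1 := by
  apply mul_left_cancel₀ hx
  rw [← mul_assoc, hz, add_mul, mul_add, smul_mul_assoc, qComm_symm h, mul_smul_comm,
    qPow_smul_qPow_smul, one_mul, mul_one]
  norm_num

lemma exch_even_swap {x y z : R} (hx : x ≠ 0) (h : x * y = qPow 2 • (y * x))
    (hz : x * z = qPow 4 • y ^ 4 + 1) : z * x = qPow (-4) • y ^ 4 + 1 := by
  apply mul_left_cancel₀ hx
  rw [← mul_assoc, hz, add_mul, mul_add, smul_mul_assoc, qComm_symm (qComm_pow_right h 4),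
    mul_smul_comm, qPow_smul_qPow_smul, one_mul, mul_one]
  norm_num

/-- The product of the two forms of the exchange relation at an odd index. -/
lemma exch_odd_mul (z : R) : (qPow 1 • z + 1) * (qPow (-1) • z + 1) =
    z * z + (qPow 1 • z + qPow (-1) • z) + 1 := by
  simp only [add_mul, mul_add, smul_add, smul_mul_assoc, mul_smul_comm, qPow_smul_qPow_smul,
    one_mul, mul_one]
  norm_num [qPow_zero_smul]
  abel

lemma exch_odd_mul' (z : R) : (qPow (-1) • z + 1) * (qPow 1 • z + 1) =
    z * z + (qPow 1 • z + qPow (-1) • z) + 1 := by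
  simp only [add_mul, mul_add, smul_add, smul_mul_assoc, mul_smul_comm, qPow_smul_qPow_smul,
    one_mul, mul_one]
  norm_num [qPow_zero_smul]
  abel

/-- Here `x, y, z, t` are four consecutive variables, `y` and `t` of even index. After
multiplication by `y` on both sides, `y t² y` splits into the two forms of the odd exchange
relation, and `y⁴` is supplied by `x z`. -/
lemma delta_odd_of_delta_even {x y z t d : R} (hy : y ≠ 0)
    (hyz : y * z = qPow 2 • (z * y)) (hxz : x * z = qPow 4 • y ^ 4 + 1)
    (hyt : y * t = qPow 1 • z + 1)
    (hd : y * d * y = z + x + (qPow 1 • 1 + qPow (-1) • 1)) :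
    d * z = qPow (-2) • t ^ 2 + qPow 2 • y ^ 2 := by
  have hty := exch_odd_swap hy hyz hyt
  apply mul_left_cancel₀ hy
  apply mul_right_cancel₀ hy
  have e1 : y * (d * z) * y = qPow (-2) • (y * d * y * z) := by
    rw [show y * (d * z) * y = y * d * (z * y) by simp only [mul_assoc], qComm_symm hyz]
    simp only [mul_smul_comm, mul_assoc]
  have e2 : y * t ^ 2 * y = z * z + (qPow 1 • z + qPow (-1) • z) + 1 := by
    rw [← exch_odd_mul, ← hyt, ← hty, sq]
    simp only [mul_assoc]
  have e3 : y * y ^ 2 * y = y ^ 4 := by rw [← pow_succ', ← pow_succ]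
  rw [e1, hd, add_mul, add_mul, hxz, mul_add, mul_smul_comm, mul_smul_comm,
    add_mul (_ • _) (_ • _) y, smul_mul_assoc, smul_mul_assoc, e2, e3, add_mul, smul_mul_assoc,
    smul_mul_assoc, one_mul]
  simp only [smul_add, qPow_smul_qPow_smul]
  norm_num
  abel

/-- Here `y, z, t, u` are consecutive and `t` is the next even variable. Together with
`delta_odd_of_delta_even` it carries the relation of `d` two steps to the right. -/
lemma delta_even_of_delta_odd {y z t u d : R} (hz : z ≠ 0)
    (hyz : y * z = qPow 2 • (z * y)) (hzt : z * t = qPow 2 • (t * z))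
    (hzu : z * u = qPow 4 • t ^ 4 + 1) (hy : y ≠ 0)
    (hyt : y * t = qPow 1 • z + 1) (hd : d * z = qPow (-2) • t ^ 2 + qPow 2 • y ^ 2) :
    t * d * t = u + z + (qPow 1 • 1 + qPow (-1) • 1) := by
  have hty := exch_odd_swap hy hyz hyt
  have huz := exch_even_swap hz hzt hzu
  apply mul_right_cancel₀ hz
  have e1 : t * d * t * z = qPow (-2) • (t * (d * z) * t) := by
    rw [mul_assoc, qComm_symm hzt]
    simp only [mul_smul_comm, mul_assoc]
  have e2 : t * y ^ 2 * t = z * z + (qPow 1 • z + qPow (-1) • z) + 1 := by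
    rw [← exch_odd_mul', ← hyt, ← hty, sq]
    simp only [mul_assoc]
  have e3 : t * t ^ 2 * t = t ^ 4 := by rw [← pow_succ', ← pow_succ]
  rw [e1, hd, add_mul, add_mul, huz, mul_add, add_mul, mul_smul_comm, mul_smul_comm,
    smul_mul_assoc, smul_mul_assoc, e2, e3, add_mul, smul_mul_assoc, smul_mul_assoc, one_mul]
  simp only [smul_add, qPow_smul_qPow_smul]
  norm_num [qPow_zero_smul]
  abel

/-! ### Symmetries: reversal of the index and even shifts. -/

lemma IsExchangeSeq.op {x : ℤ → R} (h : IsExchangeSeq x) :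
    IsExchangeSeq (fun k => MulOpposite.op (x (-k))) where
  ne_zero k := by simpa using h.ne_zero _
  comm k := by
    have := h.comm (-(k + 1))
    rw [show -(k + 1) + 1 = -k by ring] at this
    simp only [← MulOpposite.op_mul, ← MulOpposite.op_smul, this]
  exch_odd k hk := by
    have := h.exch_odd (-k) hk.neg
    rw [show -k - 1 = -(k + 1) by ring, show -k + 1 = -(k - 1) by ring] at this
    simp only [← MulOpposite.op_mul, this, MulOpposite.op_add, MulOpposite.op_smul,
      MulOpposite.op_one]
  exch_even k hk := by
    have := h.exch_even (-k) hk.neg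
    rw [show -k - 1 = -(k + 1) by ring, show -k + 1 = -(k - 1) by ring] at this
    simp only [← MulOpposite.op_mul, this, MulOpposite.op_add, MulOpposite.op_smul,
      MulOpposite.op_one, MulOpposite.op_pow]
namespace IsClusterSeq

variable {x : ℤ → R} {d : R}

lemma shift (h : IsClusterSeq x d) {n : ℤ} (hn : Even n) :
    IsClusterSeq (fun k => x (k + n)) d where
  ne_zero k := h.ne_zero _
  comm k := by
    have := h.comm (k + n)
    rwa [add_right_comm k n 1] at this
  exch_odd k hk := by
    have := h.exch_odd (k + n) (hk.add_even hn)
    rwa [add_right_comm k n 1, show k + n - 1 = k - 1 + n by ring] at this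
  exch_even k hk := by
    have := h.exch_even (k + n) (hk.add hn)
    rwa [add_right_comm k n 1, show k + n - 1 = k - 1 + n by ring] at this
  delta k hk := by
    have := h.delta (k + n) (hk.add hn)
    rwa [add_right_comm k n 1, show k + n - 1 = k - 1 + n by ring] at this

lemma op (h : IsClusterSeq x d) :
    IsClusterSeq (fun k => MulOpposite.op (x (-k))) (MulOpposite.op d) where
  toIsExchangeSeq := h.toIsExchangeSeq.op
  delta k hk := by
    have := h.delta (-k) hk.neg
    rw [show -k - 1 = -(k + 1) by ring, show -k + 1 = -(k - 1) by ring, mul_assoc] at this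
    simp only [← MulOpposite.op_mul, this, MulOpposite.op_add, MulOpposite.op_smul,
      MulOpposite.op_one]
    abel

variable (h : IsClusterSeq x d)
include h

lemma exch_odd_rev {k : ℤ} (hk : Odd k) : x (k + 1) * x (k - 1) = qPow (-1) • x k + 1 :=
  exch_odd_swap (h.ne_zero _) (by have := h.comm (k - 1); rwa [sub_add_cancel] at this)
    (h.exch_odd k hk)

lemma exch_even_rev {k : ℤ} (hk : Even k) : x (k + 1) * x (k - 1) = qPow (-4) • x k ^ 4 + 1 :=
  exch_even_swap (h.ne_zero _) (by have := h.comm (k - 1); rwa [sub_add_cancel] at this)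
    (h.exch_even k hk)

lemma delta_mul_odd {k : ℤ} (hk : Odd k) :
    d * x k = qPow (-2) • x (k + 1) ^ 2 + qPow 2 • x (k - 1) ^ 2 := by
  have hk' : Even (k - 1) := hk.sub_odd odd_one
  have h1 := h.comm (k - 1)
  have h2 := h.exch_even (k - 1) hk'
  have h3 := h.delta (k - 1) hk'
  rw [sub_add_cancel] at h1 h2 h3
  exact delta_odd_of_delta_even (h.ne_zero _) h1 h2 (h.exch_odd k hk) h3

/-- The linear recursion of the even variables. It drives both the spanning argument and the
computation of Laurent expansions. -/
lemma delta_mul_even {k : ℤ} (hk : Even k) :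
    d * x k = qPow (-1) • x (k + 2) + qPow 1 • x (k - 2) := by
  apply mul_left_cancel₀ (h.ne_zero k)
  have h1 := h.exch_odd (k + 1) (hk.add_odd odd_one)
  have h2 := h.exch_odd_rev (k := k - 1) (hk.sub_odd odd_one)
  rw [add_sub_cancel_right, add_assoc, one_add_one_eq_two] at h1
  rw [sub_add_cancel, sub_sub, one_add_one_eq_two] at h2
  rw [← mul_assoc, h.delta k hk, mul_add, mul_smul_comm, mul_smul_comm, h1, h2]
  simp only [smul_add, qPow_smul_qPow_smul]
  norm_num [qPow_zero_smul]
  abel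

lemma mul_delta_even {k : ℤ} (hk : Even k) :
    x k * d = qPow 1 • x (k + 2) + qPow (-1) • x (k - 2) := by
  apply mul_right_cancel₀ (h.ne_zero k)
  have h1 := h.exch_odd_rev (k := k + 1) (hk.add_odd odd_one)
  have h2 := h.exch_odd (k - 1) (hk.sub_odd odd_one)
  rw [add_sub_cancel_right, add_assoc, one_add_one_eq_two] at h1
  rw [sub_add_cancel, sub_sub, one_add_one_eq_two] at h2
  rw [h.delta k hk, add_mul, smul_mul_assoc, smul_mul_assoc, h1, h2]
  simp only [smul_add, qPow_smul_qPow_smul]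
  norm_num [qPow_zero_smul]
  abel

/-- Multiplication by `x k` on the left reduces this to the two odd exchange relations and the even
one. It supplies a product that occurs in `delta_mul_mem` and is not an exchange relation. -/
lemma mul_three_right {k : ℤ} (hk : Even k) :
    x (k - 2) * x (k + 1) = qPow 3 • x k ^ 3 + qPow (-1) • x (k + 2) := by
  apply mul_left_cancel₀ (h.ne_zero k)
  have h1 := h.exch_odd (k + 1) (hk.add_odd odd_one)
  have h2 := h.exch_odd_rev (k := k - 1) (hk.sub_odd odd_one)
  rw [add_sub_cancel_right, add_assoc, one_add_one_eq_two] at h1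
  rw [sub_add_cancel, sub_sub, one_add_one_eq_two] at h2
  rw [← mul_assoc, h2, mul_add, mul_smul_comm, mul_smul_comm, h1, add_mul, smul_mul_assoc,
    h.exch_even k hk, ← pow_succ']
  simp only [smul_add, qPow_smul_qPow_smul]
  norm_num [qPow_zero_smul]
  abel

lemma mul_three_left {k : ℤ} (hk : Even k) :
    x (k + 2) * x (k - 1) = qPow (-3) • x k ^ 3 + qPow 1 • x (k - 2) := by
  apply mul_left_cancel₀ (h.ne_zero k)
  have h1 := h.exch_odd (k + 1) (hk.add_odd odd_one)
  have h2 := h.exch_odd_rev (k := k - 1) (hk.sub_odd odd_one)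
  rw [add_sub_cancel_right, add_assoc, one_add_one_eq_two] at h1
  rw [sub_add_cancel, sub_sub, one_add_one_eq_two] at h2
  rw [← mul_assoc, h1, mul_add, mul_smul_comm, mul_smul_comm, h2, add_mul, smul_mul_assoc,
    h.exch_even_rev hk, ← pow_succ']
  simp only [smul_add, qPow_smul_qPow_smul]
  norm_num [qPow_zero_smul]
  abel

end IsClusterSeq

/-- The relation of `d` at one even index implies the one at the next even index. -/
lemma IsExchangeSeq.delta_add_two {x : ℤ → R} {d : R} (h : IsExchangeSeq x) {k : ℤ}
    (hk : Even k) (hd : x k * d * x k = x (k + 1) + x (k - 1) + (qPow 1 • 1 + qPow (-1) • 1)) :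
    x (k + 2) * d * x (k + 2) = x (k + 2 + 1) + x (k + 2 - 1) + (qPow 1 • 1 + qPow (-1) • 1) := by
  have h1 := h.exch_odd (k + 1) (hk.add_odd odd_one)
  have h2 := h.comm (k + 1)
  have h3 := h.exch_even (k + 2) (hk.add even_two)
  rw [add_sub_cancel_right, add_assoc, one_add_one_eq_two] at h1
  rw [add_assoc, one_add_one_eq_two] at h2
  rw [show k + 2 - 1 = k + 1 by ring] at h3 ⊢
  exact delta_even_of_delta_odd (h.ne_zero _) (h.comm k) h2 h3 (h.ne_zero k) h1
    (delta_odd_of_delta_even (h.ne_zero k) (h.comm k) (h.exch_even k hk) h1 hd)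

lemma IsExchangeSeq.delta_add {x : ℤ → R} {d : R} (h : IsExchangeSeq x) {k : ℤ}
    (hk : Even k) (hd : x k * d * x k = x (k + 1) + x (k - 1) + (qPow 1 • 1 + qPow (-1) • 1))
    (n : ℕ) : x (k + 2 * n) * d * x (k + 2 * n) =
      x (k + 2 * n + 1) + x (k + 2 * n - 1) + (qPow 1 • 1 + qPow (-1) • 1) := by
  induction n with
  | zero => simpa using hd
  | succ n ih =>
    have := h.delta_add_two (hk.add (even_two_mul (n : ℤ))) ih
    rwa [show k + 2 * (n : ℤ) + 2 = k + 2 * ((n + 1 : ℕ) : ℤ) by push_cast; ring] at this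

/-- The relation of `d` at one even index implies the relations at all even indices. -/
lemma IsExchangeSeq.isClusterSeq {x : ℤ → R} {d : R} (h : IsExchangeSeq x) {k : ℤ}
    (hk : Even k) (hd : x k * d * x k = x (k + 1) + x (k - 1) + (qPow 1 • 1 + qPow (-1) • 1)) :
    IsClusterSeq x d where
  toIsExchangeSeq := h
  delta l hl := by
    obtain ⟨n, hn | hn⟩ : ∃ n : ℕ, l = k + 2 * n ∨ l = k - 2 * n := by
      obtain ⟨a, rfl⟩ := hk
      obtain ⟨b, rfl⟩ := hl
      exact ⟨(b - a).natAbs, by omega⟩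
    · rw [hn]
      exact h.delta_add hk hd n
    -- Moving left is moving right in the reversed sequence over the opposite ring.
    · have h1 := h.op.delta_add (d := MulOpposite.op d) hk.neg (by
        rw [show -(-k + 1) = k - 1 by ring, show -(-k - 1) = k + 1 by ring, neg_neg]
        rw [mul_assoc] at hd
        simp only [← MulOpposite.op_mul, hd, MulOpposite.op_add, MulOpposite.op_smul,
          MulOpposite.op_one]
        abel) n
      rw [show -(-k + 2 * (n : ℤ) + 1) = l - 1 by rw [hn]; ring,
        show -(-k + 2 * (n : ℤ) - 1) = l + 1 by rw [hn]; ring,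
        show -(-k + 2 * (n : ℤ)) = l by rw [hn]; ring] at h1
      have h2 := congrArg MulOpposite.unop h1
      simp only [MulOpposite.unop_mul, MulOpposite.unop_op, MulOpposite.unop_add,
        MulOpposite.unop_smul, MulOpposite.unop_one, ← mul_assoc] at h2
      rw [h2]
      abel

end DivisionRing

/-! ### The cluster variables of `A_q(1,4)` -/

namespace QTorus

lemma mono_mul_mono (a b c d : ℤ) :
    mono a b * mono c d = qPow (a * d - b * c) • mono (a + c) (b + d) := by
  rw [mono, mono, mono, term_mul_term, smul_term, omega, mul_one]
  rfl

lemma mono_zero : mono 0 0 = 1 := rfl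

lemma mono_mul_mono_of_eq {a b c d e f r : ℤ} (h1 : a + c = e) (h2 : b + d = f)
    (h3 : a * d - b * c = r) : mono a b * mono c d = qPow r • mono e f := by
  rw [mono_mul_mono, h1, h2, h3]

lemma mono_pow (a b : ℤ) (n : ℕ) : mono a b ^ n = mono (n * a) (n * b) := by
  induction n with
  | zero => simp [mono_zero]
  | succ n ih =>
    rw [pow_succ, ih, mono_mul_mono_of_eq (r := 0) (e := (n + 1 : ℕ) * a) (f := (n + 1 : ℕ) * b),
      qPow_zero, one_smul]
    all_goals push_cast; ring

/-- The Laurent expansion of `X_δ`. -/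
def delta : QTorus :=
  mono (-1) (-2) + mono (-1) 2 + mono 1 (-2) + (qPow (-1) + qPow 1) • mono 0 (-2)

lemma mono_mul_delta_mul_mono : mono 0 1 * delta * mono 0 1 =
    mono (-1) 0 + mono (-1) 4 + mono 1 0 + (qPow 1 • 1 + qPow (-1) • 1) := by
  rw [delta]
  simp only [mul_add, add_mul, mul_smul_comm, smul_mul_assoc, mono_mul_mono, smul_smul,
    ← qPow_add, add_smul]
  norm_num [qPow_zero, mono_zero]
  abel

end QTorus

open QTorus

lemma qCommute_clusterVar (k : ℤ) : QCommute (clusterVar k) (clusterVar (k + 1)) := by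
  rcases le_or_gt 1 k with hk | hk
  · obtain ⟨n, rfl⟩ : ∃ n : ℕ, k = n + 1 := ⟨(k - 1).toNat, by omega⟩
    rw [clusterVar_up, show (n : ℤ) + 1 + 1 = ((n + 1 : ℕ) : ℤ) + 1 by push_cast; ring,
      clusterVar_up]
    exact qCommute_clusterUp n
  · obtain ⟨n, rfl⟩ : ∃ n : ℕ, k = 1 - ((n + 1 : ℕ) : ℤ) := ⟨(-k).toNat, by omega⟩
    rw [clusterVar_down, show 1 - ((n + 1 : ℕ) : ℤ) + 1 = 1 - (n : ℤ) by push_cast; ring,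
      clusterVar_down]
    exact qCommute_clusterDown (n + 1)

lemma isExchangeSeq_clusterVar : IsExchangeSeq clusterVar where
  ne_zero := clusterVar_ne_zero
  comm k := (qCommute_clusterVar k).2.2
  exch_odd k hk := by rw [clusterVar_exchange, exchange, if_pos hk]
  exch_even k hk := by rw [clusterVar_exchange, exchange, if_neg (Int.not_odd_iff_even.mpr hk)]

lemma clusterVar_three : clusterVar 3 = toFrac (mono (-1) 0 + mono (-1) 4) := by
  apply mul_left_cancel₀ (clusterVar_ne_zero 1)
  have h := isExchangeSeq_clusterVar.exch_even 2 even_two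
  norm_num at h
  rw [h, clusterVar_one, clusterVar_two, ← map_mul, ← map_pow, mul_add,
    mono_mul_mono_of_eq (r := 0) (e := 0) (f := 0), mono_mul_mono_of_eq (r := 4) (e := 0) (f := 4),
    mono_pow, map_add, toFrac_smul, toFrac_smul, mono_zero, map_one, qPow_zero_smul, add_comm]
  all_goals norm_num

/-- The relation of `X_δ` propagates, so it is checked at the index `2` only, by a computation in
the quantum torus. -/
lemma isClusterSeq_clusterVar : IsClusterSeq clusterVar Xdelta := by
  refine isExchangeSeq_clusterVar.isClusterSeq even_two ?_
  norm_num
  rw [clusterVar_three, clusterVar_one, clusterVar_two, Xdelta, ← map_mul, ← map_mul, ← map_add,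
    ← map_one toFrac, ← toFrac_smul, ← toFrac_smul, ← map_add, ← map_add]
  exact congrArg toFrac mono_mul_delta_mul_mono

/-! ### Spanning -/

section Span

variable {R : Type*} [DivisionRing R] [Algebra QRing R]

lemma mul_pow_eq_smul {x y : R} {c : QRing} (h : y * x = c • (x * y)) (n : ℕ) :
    y * x ^ n = c ^ n • (x ^ n * y) := by
  induction n with
  | zero => simp
  | succ n ih =>
    rw [pow_succ, ← mul_assoc, ih, smul_mul_assoc, mul_assoc, h, mul_smul_comm, smul_smul,
      mul_assoc, pow_succ]

/-- Multiplication of the cluster monomials in `E`, `O` by `d`, where `A, O', E, O, C` are five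
consecutive cluster variables. -/
lemma delta_mul_mem {V : Submodule QRing R} {d A O' E O C : R}
    {c₁ c₂ c₃ c₄ c₅ c₆ c₇ c₈ c₉ s₁ s₂ : QRing}
    (hdE : d * E = c₁ • C + c₂ • A) (hdO : d * O = s₁ • C ^ 2 + s₂ • E ^ 2)
    (hCE : C * E = c₃ • O + 1) (hAE : A * E = c₄ • O' + 1) (hO'E : O' * E = c₅ • (E * O'))
    (hOE : O * E = c₆ • (E * O)) (hO'O : O' * O = c₇ • E ^ 4 + 1)
    (hAO : A * O = c₈ • E ^ 3 + c₉ • C) (m₁ : ∀ a b : ℕ, E ^ a * O ^ b ∈ V)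
    (m₂ : ∀ a b : ℕ, C ^ a * O ^ b ∈ V) (m₃ : ∀ a : ℕ, O' * E ^ a ∈ V) (hA : A ∈ V)
    (hd : d ∈ V) (a b : ℕ) : d * (E ^ a * O ^ b) ∈ V := by
  -- An extra factor `C` either meets no `E`, which leaves a monomial in `O` and `C`, or is absorbed
  -- by `C E`.
  have hC : ∀ a b : ℕ, C * E ^ a * O ^ b ∈ V := by
    rintro (_ | a) b
    · simpa using m₂ 1 b
    · rw [pow_succ', ← mul_assoc, hCE, add_mul, add_mul, one_mul, smul_mul_assoc, smul_mul_assoc,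
        mul_pow_eq_smul hOE, smul_mul_assoc, mul_assoc, ← pow_succ']
      exact V.add_mem (V.smul_mem _ (V.smul_mem _ (m₁ _ _))) (m₁ _ _)
  -- An extra factor `A` meets nothing, or `O`, or `E`. In the last case `A E` produces `O'`, which
  -- commutes past the remaining `E`'s and is absorbed by `O' O` if an `O` is present.
  have hA : ∀ a b : ℕ, A * E ^ a * O ^ b ∈ V := by
    rintro (_ | a) (_ | b)
    · simpa using hA
    · rw [pow_zero, mul_one, pow_succ', ← mul_assoc, hAO, add_mul, smul_mul_assoc, smul_mul_assoc]
      refine V.add_mem (V.smul_mem _ (m₁ _ _)) (V.smul_mem _ ?_)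
      simpa using m₂ 1 b
    · rw [pow_zero, mul_one, pow_succ', ← mul_assoc, hAE, add_mul, one_mul, smul_mul_assoc]
      refine V.add_mem (V.smul_mem _ (m₃ _)) ?_
      simpa using m₁ a 0
    · rw [pow_succ', ← mul_assoc, hAE, add_mul, add_mul, one_mul, smul_mul_assoc, smul_mul_assoc,
        mul_pow_eq_smul hO'E, smul_mul_assoc, mul_assoc, pow_succ', ← mul_assoc O', hO'O, add_mul,
        one_mul, mul_add, smul_mul_assoc, mul_smul_comm, ← mul_assoc (E ^ a), ← pow_add,
        ← pow_succ']
      exact V.add_mem (V.smul_mem _ (V.smul_mem _ (V.add_mem (V.smul_mem _ (m₁ _ _)) (m₁ _ _))))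
        (m₁ _ _)
  rcases a with _ | a
  · rcases b with _ | b
    · simpa using hd
    · rw [pow_zero, one_mul, pow_succ', ← mul_assoc, hdO, add_mul, smul_mul_assoc, smul_mul_assoc]
      exact V.add_mem (V.smul_mem _ (m₂ _ _)) (V.smul_mem _ (m₁ _ _))
  · rw [pow_succ', mul_assoc, ← mul_assoc, hdE, add_mul, smul_mul_assoc, smul_mul_assoc,
      ← mul_assoc, ← mul_assoc]
    exact V.add_mem (V.smul_mem _ (hC _ _)) (V.smul_mem _ (hA _ _))

namespace IsClusterSeq

variable {x : ℤ → R} {d : R} (h : IsClusterSeq x d)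
include h

lemma comm_of_eq {k l : ℤ} (hl : l = k + 1) : x k * x l = qPow 2 • (x l * x k) :=
  hl ▸ h.comm k

lemma comm_rev_of_eq {k l : ℤ} (hl : l = k + 1) : x l * x k = qPow (-2) • (x k * x l) :=
  qComm_symm (h.comm_of_eq hl)

variable {V : Submodule QRing R} (hV : ∀ (m : ℤ) (a b : ℕ), x m ^ a * x (m + 1) ^ b ∈ V)
include hV

omit h in
lemma mul_mem_of_eq {k l : ℤ} (hl : l = k + 1) (a b : ℕ) : x k ^ a * x l ^ b ∈ V :=
  hl ▸ hV k a b

lemma mul_mem_rev_of_eq {k l : ℤ} (hl : l = k + 1) (a b : ℕ) : x l ^ a * x k ^ b ∈ V := by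
  have h1 := qComm_zpow (h.comm_of_eq hl) b a
  simp only [zpow_natCast] at h1
  rw [qComm_symm h1]
  exact V.smul_mem _ (mul_mem_of_eq hV hl b a)

omit h in
lemma pow_mem (k : ℤ) (a : ℕ) : x k ^ a ∈ V := by simpa using hV k a 0

lemma delta_mul_mem_right (hd : d ∈ V) {e : ℤ} (he : Even e) (a b : ℕ) :
    d * (x e ^ a * x (e + 1) ^ b) ∈ V := by
  have h1 := h.exch_odd_rev (k := e + 1) (he.add_odd odd_one)
  have h2 := h.exch_odd (e - 1) (he.sub_odd odd_one)
  have h3 := h.delta_mul_odd (k := e + 1) (he.add_odd odd_one)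
  rw [add_sub_cancel_right, add_assoc, one_add_one_eq_two] at h1 h3
  rw [sub_add_cancel, sub_sub, one_add_one_eq_two] at h2
  exact delta_mul_mem (h.delta_mul_even he) h3 h1 h2 (h.comm_of_eq (by ring))
    (h.comm_rev_of_eq (by ring)) (h.exch_even e he) (h.mul_three_right he)
    (mul_mem_of_eq hV (by ring)) (h.mul_mem_rev_of_eq hV (by ring))
    (fun a => by simpa using mul_mem_of_eq hV (show e = e - 1 + 1 by ring) 1 a)
    (by simpa using pow_mem hV (e - 2) 1) hd a b

/-- The same five variables read from right to left; `delta_mul_mem` leaves its coefficients free so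
that both readings fit. -/
lemma delta_mul_mem_left (hd : d ∈ V) {e : ℤ} (he : Even e) (a b : ℕ) :
    d * (x e ^ a * x (e - 1) ^ b) ∈ V := by
  have h1 := h.exch_odd_rev (k := e + 1) (he.add_odd odd_one)
  have h2 := h.exch_odd (e - 1) (he.sub_odd odd_one)
  have h3 := h.delta_mul_odd (k := e - 1) (he.sub_odd odd_one)
  have h4 := h.delta_mul_even he
  rw [add_sub_cancel_right, add_assoc, one_add_one_eq_two] at h1
  rw [sub_add_cancel, sub_sub, one_add_one_eq_two] at h2 h3
  rw [add_comm] at h3 h4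
  exact delta_mul_mem h4 h3 h2 h1 (h.comm_rev_of_eq (by ring))
    (h.comm_of_eq (by ring)) (h.exch_even_rev he) (h.mul_three_left he)
    (h.mul_mem_rev_of_eq hV (by ring)) (mul_mem_of_eq hV (by ring))
    (fun a => by simpa using h.mul_mem_rev_of_eq hV (show e + 1 = e + 1 by ring) 1 a)
    (by simpa using pow_mem hV (e + 2) 1) hd a b

lemma delta_mul_mem_span (hd : d ∈ V) (m : ℤ) (a b : ℕ) :
    d * (x m ^ a * x (m + 1) ^ b) ∈ V := by
  rcases Int.even_or_odd m with hm | hm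
  · exact h.delta_mul_mem_right hV hd hm a b
  · have h1 := qComm_zpow (h.comm m) a b
    simp only [zpow_natCast] at h1
    have h2 := h.delta_mul_mem_left hV hd (hm.add_odd odd_one) b a
    rw [add_sub_cancel_right] at h2
    rw [h1, mul_smul_comm]
    exact V.smul_mem _ h2

omit hV in
/-- If `V` is closed under left multiplication by `d`, then `x k * v ∈ V` for two consecutive even
`k` implies it for all even `k`. -/
lemma even_mul_mem (hdV : ∀ v ∈ V, d * v ∈ V) {e : ℤ} (he : Even e) {v : R}
    (h1 : x e * v ∈ V) (h2 : x (e + 2) * v ∈ V) {k : ℤ} (hk : Even k) : x k * v ∈ V := by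
  have up : ∀ k, Even k → x k * v ∈ V → x (k + 2) * v ∈ V → x (k + 4) * v ∈ V := by
    intro k hk hk1 hk2
    have h3 := h.delta_mul_even (hk.add even_two)
    rw [add_sub_cancel_right, add_assoc] at h3
    norm_num at h3
    have h4 : x (k + 4) * v = qPow 1 • (d * (x (k + 2) * v)) - qPow 2 • (x k * v) := by
      rw [← mul_assoc, h3]
      simp only [add_mul, smul_add, smul_mul_assoc, qPow_smul_qPow_smul]
      norm_num [qPow_zero_smul]
    rw [h4]
    exact V.sub_mem (V.smul_mem _ (hdV _ hk2)) (V.smul_mem _ hk1)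
  have down : ∀ k, Even k → x k * v ∈ V → x (k + 2) * v ∈ V → x (k - 2) * v ∈ V := by
    intro k hk hk1 hk2
    have h3 := h.delta_mul_even hk
    have h4 : x (k - 2) * v = qPow (-1) • (d * (x k * v)) - qPow (-2) • (x (k + 2) * v) := by
      rw [← mul_assoc, h3]
      simp only [add_mul, smul_add, smul_mul_assoc, qPow_smul_qPow_smul]
      norm_num [qPow_zero_smul]
    rw [h4]
    exact V.sub_mem (V.smul_mem _ (hdV _ hk1)) (V.smul_mem _ hk2)
  have hup : ∀ n : ℕ, x (e + 2 * n) * v ∈ V ∧ x (e + 2 * n + 2) * v ∈ V := by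
    intro n
    induction n with
    | zero => simpa using ⟨h1, h2⟩
    | succ n ih =>
      have h3 := up _ (he.add (even_two_mul (n : ℤ))) ih.1 ih.2
      rw [show e + 2 * ((n + 1 : ℕ) : ℤ) = e + 2 * n + 2 by push_cast; ring]
      refine ⟨ih.2, ?_⟩
      rwa [add_assoc (e + 2 * (n : ℤ)) 2 2]
  have hdown : ∀ n : ℕ, x (e - 2 * n) * v ∈ V ∧ x (e - 2 * n + 2) * v ∈ V := by
    intro n
    induction n with
    | zero => simpa using ⟨h1, h2⟩
    | succ n ih =>
      have h3 := down _ (he.sub (even_two_mul (n : ℤ))) ih.1 ih.2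
      rw [show e - 2 * ((n + 1 : ℕ) : ℤ) = e - 2 * n - 2 by push_cast; ring]
      refine ⟨h3, ?_⟩
      rw [sub_add_cancel]
      exact ih.1
  obtain ⟨n, rfl | rfl⟩ : ∃ n : ℕ, k = e + 2 * n ∨ k = e - 2 * n := by
    obtain ⟨a, rfl⟩ := hk
    obtain ⟨b, rfl⟩ := he
    exact ⟨(b - a).natAbs, by omega⟩
  · exact (hup n).1
  · exact (hdown n).1

lemma even_mul_mem_span (hdV : ∀ v ∈ V, d * v ∈ V) {k : ℤ} (hk : Even k) (m : ℤ) (a b : ℕ) :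
    x k * (x m ^ a * x (m + 1) ^ b) ∈ V := by
  rcases Int.even_or_odd m with hm | hm
  -- The two starting indices for the recursion are `m` and `m + 2`: the first variable lies in the
  -- cluster, the second is exchanged with `x m`.
  · refine h.even_mul_mem hdV hm ?_ ?_ hk
    · rw [← mul_assoc, ← pow_succ']
      exact hV _ _ _
    · rcases a with _ | a
      · have := h.mul_mem_rev_of_eq hV (show m + 2 = m + 1 + 1 by ring) 1 b
        simpa using this
      · have h1 := h.exch_odd_rev (k := m + 1) (hm.add_odd odd_one)
        rw [add_sub_cancel_right, add_assoc, one_add_one_eq_two] at h1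
        rw [pow_succ', mul_assoc, ← mul_assoc, h1, add_mul, smul_mul_assoc, ← mul_assoc,
          mul_pow_eq_smul (h.comm_rev_of_eq rfl), smul_mul_assoc, mul_assoc, ← pow_succ', one_mul]
        exact V.add_mem (V.smul_mem _ (V.smul_mem _ (hV _ _ _))) (hV _ _ _)
  -- For odd `m` the starting indices are `m - 1` and `m + 1`.
  · refine h.even_mul_mem hdV (hm.sub_odd odd_one) ?_ ?_ hk
    · rcases b with _ | b
      · have := mul_mem_of_eq hV (show m = m - 1 + 1 by ring) 1 a
        simpa using this
      · have h0 := qComm_zpow (h.comm m) a (b + 1 : ℕ)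
        simp only [zpow_natCast] at h0
        rw [h0, mul_smul_comm, pow_succ', mul_assoc (x (m + 1)), ← mul_assoc (x (m - 1)),
          h.exch_odd m hm, add_mul,
          smul_mul_assoc, ← mul_assoc, mul_pow_eq_smul (h.comm m), smul_mul_assoc,
          mul_assoc (x (m + 1) ^ b), ← pow_succ', one_mul]
        exact V.smul_mem _ (V.add_mem (V.smul_mem _ (V.smul_mem _
          (h.mul_mem_rev_of_eq hV rfl _ _))) (h.mul_mem_rev_of_eq hV rfl _ _))
    · rw [show m - 1 + 2 = m + 1 by ring, ← mul_assoc,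
        mul_pow_eq_smul (h.comm_rev_of_eq rfl), smul_mul_assoc, mul_assoc, ← pow_succ']
      exact V.smul_mem _ (hV _ _ _)

/-- Each factor `d` is consumed by `x k * d = q^{1/2} x (k + 2) + q^{-1/2} x (k - 2)`, so the
product is a combination of even variables alone. -/
lemma even_mul_delta_pow_mem {k : ℤ} (hk : Even k) (n : ℕ) : x k * d ^ n ∈ V := by
  induction n generalizing k with
  | zero => simpa using pow_mem hV k 1
  | succ n ih =>
    rw [pow_succ', ← mul_assoc, h.mul_delta_even hk, add_mul, smul_mul_assoc, smul_mul_assoc]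
    exact V.add_mem (V.smul_mem _ (ih (hk.add even_two))) (V.smul_mem _ (ih (hk.sub even_two)))

lemma even_mul_aeval_mem [Algebra ℤ R] {k : ℤ} (hk : Even k) (p : Polynomial ℤ) :
    x k * Polynomial.aeval d p ∈ V := by
  induction p using Polynomial.induction_on' with
  | add p q hp hq =>
    rw [map_add, mul_add]
    exact V.add_mem hp hq
  | monomial n c =>
    rw [Polynomial.aeval_monomial, eq_intCast, ← zsmul_eq_mul, mul_smul_comm]
    exact V.toAddSubgroup.zsmul_mem (h.even_mul_delta_pow_mem hV hk n) c

omit hV in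
-- Since `x 1 * x 3 = q² (x 2)⁴ + 1`, one has `d = (d * x 1) * x 3 - q² (d * x 2) * (x 2)³`, and
-- both products with `d` are known. Hence `X_δ` belongs to the cluster algebra.
lemma delta_eq : d = (qPow (-2) • x 2 ^ 2 + qPow 2 • x 0 ^ 2) * x 3 -
    qPow 4 • ((qPow (-1) • x 4 + qPow 1 • x 0) * x 2 ^ 3) := by
  have h1 := h.delta_mul_odd odd_one
  have h2 := h.exch_even 2 even_two
  have h3 := h.delta_mul_even even_two
  norm_num at h1 h2 h3
  rw [← h1, ← h3, mul_assoc, mul_assoc, h2, ← pow_succ', mul_add, mul_smul_comm]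
  norm_num

end IsClusterSeq

end Span

/-! ### The span of `𝓑` is the cluster algebra. -/

lemma clusterMono_natCast (m : ℤ) (a b : ℕ) : clusterMono m a b =
    qPow (-(a * b)) • (clusterVar m ^ a * clusterVar (m + 1) ^ b) := by
  rw [clusterMono, zpow_natCast, zpow_natCast]

lemma mul_pow_mem_span_basisB (m : ℤ) (a b : ℕ) :
    clusterVar m ^ a * clusterVar (m + 1) ^ b ∈ Submodule.span QRing basisB := by
  rw [eq_qPow_smul_iff.mp (clusterMono_natCast m a b)]
  exact Submodule.smul_mem _ _ (Submodule.subset_span (Or.inl ⟨m, a, b, rfl⟩))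

lemma aeval_chebF_mem_span_basisB (n : ℕ) :
    Polynomial.aeval Xdelta (chebF n) ∈ Submodule.span QRing basisB :=
  Submodule.subset_span (Or.inr ⟨n, rfl⟩)

lemma Xdelta_mem_span_basisB : Xdelta ∈ Submodule.span QRing basisB := by
  have := aeval_chebF_mem_span_basisB 1
  rwa [chebF, Polynomial.aeval_X] at this

lemma Xdelta_mul_chebF_mem_span_basisB (n : ℕ) :
    Xdelta * Polynomial.aeval Xdelta (chebF n) ∈ Submodule.span QRing basisB := by
  have hX : ∀ p : Polynomial ℤ, Xdelta * Polynomial.aeval Xdelta p =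
      Polynomial.aeval Xdelta (p * Polynomial.X) := by
    intro p
    rw [mul_comm, map_mul, Polynomial.aeval_X]
  rcases n with _ | _ | n
  · simpa [chebF] using Xdelta_mem_span_basisB
  -- The constant `-2` in `F_2` makes this product exceptional: `F_1 x = F_2 + 2 F_0`.
  · have h1 : chebF 1 * Polynomial.X = chebF 2 + (chebF 0 + chebF 0) := by
      simp only [chebF]
      ring
    rw [zero_add, hX, h1, map_add, map_add]
    exact add_mem (aeval_chebF_mem_span_basisB 2)
      (add_mem (aeval_chebF_mem_span_basisB 0) (aeval_chebF_mem_span_basisB 0))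
  · have h1 : chebF (n + 2) * Polynomial.X = chebF (n + 3) + chebF (n + 1) := by
      simp only [chebF]
      ring
    rw [add_assoc, one_add_one_eq_two, hX, h1, map_add]
    exact add_mem (aeval_chebF_mem_span_basisB _) (aeval_chebF_mem_span_basisB _)

lemma Xdelta_mul_mem_span_basisB {v : QFrac} (hv : v ∈ Submodule.span QRing basisB) :
    Xdelta * v ∈ Submodule.span QRing basisB := by
  induction hv using Submodule.span_induction with
  | mem v hv =>
    rcases hv with ⟨m, a, b, rfl⟩ | ⟨n, rfl⟩
    · rw [clusterMono_natCast, mul_smul_comm]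
      exact Submodule.smul_mem _ _ (isClusterSeq_clusterVar.delta_mul_mem_span
        mul_pow_mem_span_basisB Xdelta_mem_span_basisB m a b)
    · exact Xdelta_mul_chebF_mem_span_basisB n
  | zero => rw [mul_zero]; exact zero_mem _
  | add u v _ _ hu hv => rw [mul_add]; exact add_mem hu hv
  | smul c v _ hv => rw [mul_smul_comm]; exact Submodule.smul_mem _ _ hv

lemma clusterVar_even_mul_mem_span_basisB {k : ℤ} (hk : Even k) {v : QFrac}
    (hv : v ∈ Submodule.span QRing basisB) : clusterVar k * v ∈ Submodule.span QRing basisB := by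
  induction hv using Submodule.span_induction with
  | mem v hv =>
    rcases hv with ⟨m, a, b, rfl⟩ | ⟨n, rfl⟩
    · rw [clusterMono_natCast, mul_smul_comm]
      exact Submodule.smul_mem _ _ (isClusterSeq_clusterVar.even_mul_mem_span
        mul_pow_mem_span_basisB (fun _ => Xdelta_mul_mem_span_basisB) hk m a b)
    · exact isClusterSeq_clusterVar.even_mul_aeval_mem mul_pow_mem_span_basisB hk _
  | zero => rw [mul_zero]; exact zero_mem _
  | add u v _ _ hu hv => rw [mul_add]; exact add_mem hu hv
  | smul c v _ hv => rw [mul_smul_comm]; exact Submodule.smul_mem _ _ hv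

/-- An odd variable is, up to a power of `q`, the product of its two even neighbours minus one. -/
lemma clusterVar_mul_mem_span_basisB (k : ℤ) {v : QFrac}
    (hv : v ∈ Submodule.span QRing basisB) : clusterVar k * v ∈ Submodule.span QRing basisB := by
  rcases Int.even_or_odd k with hk | hk
  · exact clusterVar_even_mul_mem_span_basisB hk hv
  · have h1 := isClusterSeq_clusterVar.exch_odd k hk
    have h2 : clusterVar k * v =
        qPow (-1) • (clusterVar (k - 1) * (clusterVar (k + 1) * v)) - qPow (-1) • v := by
      rw [← mul_assoc, h1, add_mul, one_mul, smul_mul_assoc, smul_add, qPow_smul_qPow_smul]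
      norm_num [qPow_zero_smul]
    rw [h2]
    exact sub_mem (Submodule.smul_mem _ _ (clusterVar_even_mul_mem_span_basisB
      (hk.sub_odd odd_one) (clusterVar_even_mul_mem_span_basisB (hk.add_odd odd_one) hv)))
      (Submodule.smul_mem _ _ hv)

lemma clusterVar_mem_clusterAlgebra (k : ℤ) : clusterVar k ∈ clusterAlgebra :=
  Algebra.subset_adjoin ⟨k, rfl⟩

lemma Xdelta_mem_clusterAlgebra : Xdelta ∈ clusterAlgebra := by
  have hx := clusterVar_mem_clusterAlgebra
  rw [isClusterSeq_clusterVar.delta_eq]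
  exact sub_mem (mul_mem (add_mem (Subalgebra.smul_mem _ (pow_mem (hx _) _) _)
    (Subalgebra.smul_mem _ (pow_mem (hx _) _) _)) (hx _))
    (Subalgebra.smul_mem _ (mul_mem (add_mem (Subalgebra.smul_mem _ (hx _) _)
    (Subalgebra.smul_mem _ (hx _) _)) (pow_mem (hx _) _)) _)

theorem span_basisB : Submodule.span QRing basisB = Subalgebra.toSubmodule clusterAlgebra := by
  apply le_antisymm
  · rw [Submodule.span_le]
    rintro _ (⟨m, a, b, rfl⟩ | ⟨n, rfl⟩)
    · rw [clusterMono_natCast]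
      exact Subalgebra.smul_mem _ (mul_mem (pow_mem (clusterVar_mem_clusterAlgebra _) _)
        (pow_mem (clusterVar_mem_clusterAlgebra _) _)) _
    · have h1 : Algebra.adjoin ℤ {Xdelta} ≤ clusterAlgebra.restrictScalars ℤ :=
        Algebra.adjoin_le (Set.singleton_subset_iff.mpr Xdelta_mem_clusterAlgebra)
      exact h1 (Polynomial.aeval_mem_adjoin_singleton ℤ Xdelta)
  · intro y hy
    -- Stability under left multiplication passes from the generators to the whole algebra; it is
    -- then applied to `1`, which lies in the span.
    have key : ∀ v ∈ Submodule.span QRing basisB, y * v ∈ Submodule.span QRing basisB := by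
      refine Algebra.adjoin_induction (p := fun y _ => ∀ v ∈ Submodule.span QRing basisB,
        y * v ∈ Submodule.span QRing basisB) ?_ ?_ ?_ ?_ hy
      · rintro _ ⟨k, rfl⟩ v hv
        exact clusterVar_mul_mem_span_basisB k hv
      · intro c v hv
        rw [← Algebra.smul_def]
        exact Submodule.smul_mem _ _ hv
      · intro u w _ _ hu hw v hv
        rw [add_mul]
        exact add_mem (hu v hv) (hw v hv)
      · intro u w _ _ hu hw v hv
        rw [mul_assoc]
        exact hu _ (hw v hv)
    have h1 := key 1 (by simpa using mul_pow_mem_span_basisB 0 0 0)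
    rwa [mul_one] at h1

/-! ### Laurent expansions -/

lemma qPow_injective : Function.Injective qPow := by
  intro r s h
  by_contra hne
  refine qPow_ne_one (sub_ne_zero.mpr hne) ?_
  rw [sub_eq_add_neg, qPow_add, h, ← qPow_add, add_neg_cancel, qPow_zero]

namespace QTorus

lemma term_eq_smul_mono (m : ℤ × ℤ) (c : QRing) : term m c = c • mono m.1 m.2 := by
  rw [mono, smul_term, mul_one]

lemma coeff_mono (a b : ℤ) (m : ℤ × ℤ) : (mono a b).coeff m = if (a, b) = m then 1 else 0 :=
  coeff_term _ _ _

lemma coeff_mono_self (a b : ℤ) : (mono a b).coeff (a, b) = 1 := by rw [coeff_mono, if_pos rfl]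

lemma mono_mul_mono_neg (a b : ℤ) : mono a b * mono (-a) (-b) = 1 := by
  rw [mono_mul_mono_of_eq (add_neg_cancel a) (add_neg_cancel b) (r := 0) (by ring), qPow_zero,
    one_smul, mono_zero]

/-- Conjugation by monomials is diagonal in the basis of monomials, and its eigenvalues separate the
exponents. -/
lemma coeff_conj_mono (a b : ℤ) (f : QTorus) (m : ℤ × ℤ) :
    (mono a b * f * mono (-a) (-b)).coeff m = qPow (2 * omega (a, b) m) * f.coeff m := by
  induction f using QTorus.induction with
  | h0 => simp
  | hadd f g hf hg => rw [mul_add, add_mul, coeff_add, hf, hg, coeff_add, mul_add]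
  | ht n c =>
    have hn : (a, b) + n + (-a, -b) = n := by ext <;> simp
    rw [mono, mono, term_mul_term, term_mul_term, hn, coeff_term, coeff_term]
    split_ifs with h
    · rw [← h, mul_one, one_mul, ← mul_assoc, ← qPow_add]
      congr 2
      simp only [omega, Prod.fst_add, Prod.snd_add]
      ring
    · rw [mul_zero]

/-- The coefficients after the exchange of the two variables. -/
def swap : QTorus →ₗ[QRing] QTorus :=
  (Finsupp.lmapDomain QRing QRing Prod.swap : ((ℤ × ℤ) →₀ QRing) →ₗ[QRing] (ℤ × ℤ) →₀ QRing)

lemma swap_mono (a b : ℤ) : swap (mono a b) = mono b a :=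
  Finsupp.mapDomain_single

lemma coeff_swap (f : QTorus) (a b : ℤ) : (swap f).coeff (a, b) = f.coeff (b, a) :=
  Finsupp.mapDomain_apply Prod.swap_injective (show (ℤ × ℤ) →₀ QRing from f) (b, a)

end QTorus

section LaurentHom

variable {R : Type*} [DivisionRing R] [Algebra QRing R]

/-- An element of the kernel with at least two exponents can be shortened: conjugating it by a
suitable monomial and subtracting a multiple of it kills one term but keeps another. A single term
is a scalar times a unit, so it cannot lie in the kernel. -/
lemma torus_algHom_injective (φ : QTorus →ₐ[QRing] R)
    (hR : Function.Injective (algebraMap QRing R)) : Function.Injective φ := by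
  have key : ∀ (n : ℕ) (f : QTorus), f.supp.card ≤ n → φ f = 0 → f = 0 := by
    intro n
    induction n with
    | zero =>
      intro f hf _
      by_contra h
      exact (supp_nonempty h).card_pos.ne' (Nat.le_zero.mp hf)
    | succ n ih =>
      intro f hf h0
      by_contra hne
      obtain ⟨m, hm⟩ := supp_nonempty hne
      by_cases hone : ∀ n ∈ f.supp, n = m
      · have hf' : f = f.coeff m • mono m.1 m.2 := by
          refine QTorus.ext fun k => ?_
          rw [coeff_smul, coeff_mono]
          split_ifs with hk
          · rw [mul_one]
            exact congrArg f.coeff hk.symm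
          · rw [mul_zero]
            by_contra hk'
            exact hk (hone k (mem_supp.mpr hk')).symm
        have h1 : algebraMap QRing R (f.coeff m) = 0 := by
          have h2 := congrArg (fun z => φ z * φ (mono (-m.1) (-m.2))) hf'
          simp only [h0, zero_mul, map_smul, smul_mul_assoc] at h2
          rw [← map_mul, mono_mul_mono_neg, map_one, ← Algebra.algebraMap_eq_smul_one] at h2
          exact h2.symm
        exact mem_supp.mp hm (hR (h1.trans (map_zero _).symm))
      · push Not at hone
        obtain ⟨k, hk, hkm⟩ := hone
        -- The skew form is non-degenerate, so some `e` distinguishes `k` from `m`.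
        obtain ⟨e, he⟩ : ∃ e : ℤ × ℤ, omega e k ≠ omega e m := by
          by_contra! hc
          have h1 := hc (1, 0)
          have h2 := hc (0, 1)
          simp only [omega] at h1 h2
          exact hkm (Prod.ext (by omega) (by omega))
        set g := mono e.1 e.2 * f * mono (-e.1) (-e.2) - qPow (2 * omega e m) • f with hg
        have hcoeff : ∀ l, g.coeff l =
            (qPow (2 * omega e l) - qPow (2 * omega e m)) * f.coeff l := by
          intro l
          rw [hg, coeff_sub, coeff_conj_mono, coeff_smul, sub_mul]
        have hg0 : g = 0 := by
          refine ih g ?_ (by rw [hg, map_sub, map_mul, map_mul, map_smul, h0]; simp)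
          have hsub : g.supp ⊆ f.supp.erase m := by
            intro l hl
            rw [mem_supp, hcoeff] at hl
            refine Finset.mem_erase.mpr ⟨?_, mem_supp.mpr (right_ne_zero_of_mul hl)⟩
            rintro rfl
            exact hl (by rw [sub_self, zero_mul])
          have h1 := Finset.card_le_card hsub
          rw [Finset.card_erase_of_mem hm] at h1
          omega
        have h1 := hcoeff k
        rw [hg0, coeff_zero] at h1
        refine mul_ne_zero (sub_ne_zero.mpr fun h2 => he ?_) (mem_supp.mp hk) h1.symm
        have := qPow_injective h2
        omega
  rw [injective_iff_map_eq_zero]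
  exact fun f => key _ f le_rfl

lemma laurent_mul {u v : R} (hu : u ≠ 0) (hv : v ≠ 0) (h : u * v = qPow 2 • (v * u))
    (a b c d : ℤ) :
    (qPow (-(a * b)) • (u ^ a * v ^ b)) * (qPow (-(c * d)) • (u ^ c * v ^ d)) =
      qPow (a * d - b * c) • qPow (-((a + c) * (b + d))) • (u ^ (a + c) * v ^ (b + d)) := by
  have h1 := qComm_symm (qComm_zpow h c b)
  have h2 : u ^ a * v ^ b * (u ^ c * v ^ d) =
      qPow (-(2 * c * b)) • (u ^ (a + c) * v ^ (b + d)) := by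
    rw [mul_assoc, ← mul_assoc (v ^ b), h1, smul_mul_assoc, mul_smul_comm, zpow_add₀ hu,
      zpow_add₀ hv]
    simp only [mul_assoc]
  rw [smul_mul_assoc, mul_smul_comm, h2, qPow_smul_qPow_smul, qPow_smul_qPow_smul,
    qPow_smul_qPow_smul]
  congr 2
  ring

/-- The homomorphism from the quantum torus that sends `X₁` to `u` and `X₂` to `v`. -/
def laurentHom (u v : R) (hu : u ≠ 0) (hv : v ≠ 0) (h : u * v = qPow 2 • (v * u)) :
    QTorus →ₐ[QRing] R :=
  let L : QTorus →ₗ[QRing] R := (Finsupp.linearCombination QRing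
    (fun e : ℤ × ℤ => qPow (-(e.1 * e.2)) • (u ^ e.1 * v ^ e.2)) : ((ℤ × ℤ) →₀ QRing) →ₗ[QRing] R)
  have hL : ∀ a b, L (mono a b) = qPow (-(a * b)) • (u ^ a * v ^ b) := fun a b =>
    (Finsupp.linearCombination_single QRing (1 : QRing) (a, b)).trans (one_smul _ _)
  AlgHom.ofLinearMap L
    (by rw [← mono_zero, hL]; simp [qPow_zero])
    (by
      intro f g
      induction f using QTorus.induction with
      | h0 => simp
      | hadd f f' hf hf' => rw [add_mul, map_add, hf, hf', map_add, add_mul]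
      | ht m c =>
        induction g using QTorus.induction with
        | h0 => simp
        | hadd g g' hg hg' => rw [mul_add, map_add, hg, hg', map_add, mul_add]
        | ht n e =>
          rw [term_eq_smul_mono, term_eq_smul_mono, smul_mul_assoc, mul_smul_comm, mono_mul_mono,
            map_smul, map_smul, map_smul, map_smul, map_smul, hL, hL, hL, smul_mul_assoc,
            mul_smul_comm, laurent_mul hu hv h])

lemma laurentHom_mono {u v : R} (hu : u ≠ 0) (hv : v ≠ 0) (h : u * v = qPow 2 • (v * u))
    (a b : ℤ) : laurentHom u v hu hv h (mono a b) = qPow (-(a * b)) • (u ^ a * v ^ b) :=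
  (Finsupp.linearCombination_single QRing (1 : QRing) (a, b)).trans (one_smul _ _)

end LaurentHom

/-! ### Degrees -/

namespace QTorus

/-- The elements all of whose exponents `(a, b)` satisfy `u a + v b ≤ N`. -/
def degLE (u v N : ℤ) : Submodule QRing QTorus where
  carrier := {f | ∀ m, f.coeff m ≠ 0 → u * m.1 + v * m.2 ≤ N}
  zero_mem' m hm := absurd (coeff_zero m) hm
  add_mem' {f g} hf hg m hm := by
    by_cases h : f.coeff m = 0
    · rw [coeff_add, h, zero_add] at hm
      exact hg m hm
    · exact hf m h
  smul_mem' c f hf m hm := by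
    rw [coeff_smul] at hm
    exact hf m (right_ne_zero_of_mul hm)

lemma mono_mem_degLE {u v N a b : ℤ} (h : u * a + v * b ≤ N) : mono a b ∈ degLE u v N := by
  intro m hm
  rw [coeff_mono] at hm
  split_ifs at hm with h1
  · rwa [← h1]
  · exact absurd rfl hm

lemma one_mem_degLE {u v N : ℤ} (h : 0 ≤ N) : (1 : QTorus) ∈ degLE u v N :=
  mono_mem_degLE (a := 0) (b := 0) (by simpa using h)

lemma degLE_mono {u v N M : ℤ} (h : N ≤ M) : degLE u v N ≤ degLE u v M :=
  fun _ hf m hm => (hf m hm).trans h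

lemma mul_mem_degLE {u v N M K : ℤ} {f g : QTorus} (hf : f ∈ degLE u v N) (hg : g ∈ degLE u v M)
    (hK : N + M ≤ K) : f * g ∈ degLE u v K := by
  intro k hk
  obtain ⟨m, hm, n, hn, rfl⟩ := exists_of_mem_supp_mul (mem_supp.mpr hk)
  have h1 := hf m (mem_supp.mp hm)
  have h2 := hg n (mem_supp.mp hn)
  rw [Prod.fst_add, Prod.snd_add]
  linarith

lemma pow_mem_degLE {u v N : ℤ} {f : QTorus} (hf : f ∈ degLE u v N) (n : ℕ) :
    f ^ n ∈ degLE u v (n * N) := by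
  induction n with
  | zero => simpa using one_mem_degLE le_rfl
  | succ n ih =>
    rw [pow_succ]
    refine mul_mem_degLE ih hf ?_
    push_cast
    linarith

/-- Two bounds on exponents imply every non-negative combination of them. -/
lemma mem_degLE_of_comb {u v N u' v' N' u'' v'' N'' : ℤ} (α β : ℤ) (hα : 0 ≤ α) (hβ : 0 ≤ β)
    {f : QTorus} (hf : f ∈ degLE u v N) (hf' : f ∈ degLE u' v' N')
    (hu : u'' = α * u + β * u') (hv : v'' = α * v + β * v') (hN : α * N + β * N' ≤ N'') :
    f ∈ degLE u'' v'' N'' := by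
  intro m hm
  have h1 := mul_le_mul_of_nonneg_left (hf m hm) hα
  have h2 := mul_le_mul_of_nonneg_left (hf' m hm) hβ
  rw [hu, hv]
  linarith

lemma coeff_eq_zero_of_mem_degLE {u v N : ℤ} {f : QTorus} (hf : f ∈ degLE u v N) {m : ℤ × ℤ}
    (hm : N < u * m.1 + v * m.2) : f.coeff m = 0 := by
  by_contra h
  exact absurd (hf m h) (not_le.mpr hm)

/-- No exponent of `f` lies in the first quadrant, unless `f` is a monomial. -/
def QuadrantFree (f : QTorus) : Prop := ∀ i j : ℕ, f.coeff (i, j) = 0 ∨ f = mono i j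

lemma quadrantFree_mono (a b : ℕ) : QuadrantFree (mono a b) := by
  intro i j
  rw [coeff_mono]
  split_ifs with h
  · right
    rw [Prod.mk.injEq] at h
    rw [h.1, h.2]
  · exact Or.inl rfl

/-- A form with non-negative coefficients is non-negative on the first quadrant, so the bound `-1`
excludes it. -/
lemma quadrantFree_of_mem_degLE {u v : ℤ} (hu : 0 ≤ u) (hv : 0 ≤ v) {f : QTorus}
    (hf : f ∈ degLE u v (-1)) : QuadrantFree f := by
  intro i j
  left
  refine coeff_eq_zero_of_mem_degLE hf ?_
  have := mul_nonneg hu (Int.natCast_nonneg i)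
  have := mul_nonneg hv (Int.natCast_nonneg j)
  simp only
  linarith

lemma monomial_mem_degLE {u v : ℤ} {f g : QTorus} (hf : f ∈ degLE u v (-1))
    (hg : g ∈ degLE u v (-1)) (r : ℤ) (a b : ℕ) :
    qPow r • (f ^ a * g ^ b) ∈ degLE u v (-(a + b)) :=
  Submodule.smul_mem _ _ (mul_mem_degLE (pow_mem_degLE hf a) (pow_mem_degLE hg b) (by linarith))

lemma quadrantFree_monomial {u v : ℤ} (hu : 0 ≤ u) (hv : 0 ≤ v) {f g : QTorus}
    (hf : f ∈ degLE u v (-1)) (hg : g ∈ degLE u v (-1)) (a b : ℕ) :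
    QuadrantFree (qPow (-(a * b)) • (f ^ a * g ^ b)) := by
  by_cases h : a = 0 ∧ b = 0
  · rw [h.1, h.2]
    simpa [qPow_zero, mono_zero] using quadrantFree_mono 0 0
  · exact quadrantFree_of_mem_degLE hu hv
      (degLE_mono (by omega) (monomial_mem_degLE hf hg _ a b))

end QTorus

/-! ### Exponents of the cluster variables

The sign `ε` distinguishes the two directions in which one moves away from the cluster
`{x 1, x 2}`. -/

namespace QTorus

/-- The part of `X_δ` below the line `2a + b = 0`. -/
def deltaLow : QTorus := mono (-1) (-2) + (qPow (-1) + qPow 1) • mono 0 (-2)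

lemma delta_eq_add {ε : ℤ} (hε : ε = 1 ∨ ε = -1) :
    delta = mono ε (-2 * ε) + mono (-ε) (2 * ε) + deltaLow := by
  rcases hε with rfl | rfl
  · rw [delta, deltaLow]
    norm_num
    abel
  · rw [delta, deltaLow]
    norm_num
    abel

/-- The elements of degree at most `-1` for `2a + b` and at most `N` for `(2 + 2ε)a + b`. -/
def lowPart (ε N : ℤ) : Submodule QRing QTorus := degLE 2 1 (-1) ⊓ degLE (2 + 2 * ε) 1 N

lemma lowPart_mono {ε N M : ℤ} (h : N ≤ M) : lowPart ε N ≤ lowPart ε M :=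
  inf_le_inf_left _ (degLE_mono h)

lemma deltaLow_mem_fst : deltaLow ∈ degLE 2 1 (-2) :=
  add_mem (mono_mem_degLE (by norm_num)) (Submodule.smul_mem _ _ (mono_mem_degLE (by norm_num)))

lemma deltaLow_mem_snd {ε : ℤ} (hε : ε = 1 ∨ ε = -1) : deltaLow ∈ degLE (2 + 2 * ε) 1 (-2) :=
  add_mem (mono_mem_degLE (by omega)) (Submodule.smul_mem _ _ (mono_mem_degLE (by omega)))

/-- The top exponent, for `2a + b`, of the `i`-th even cluster variable. -/
def topMono (ε i : ℤ) : QTorus := mono (-((i - 1) * ε)) (1 + 2 * ((i - 1) * ε))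

/-- The extremal exponent of degree `-1` of the `i`-th even cluster variable. -/
def lowMono (ε i : ℤ) : QTorus := mono ((i - 2) * ε) (-1 - 2 * ((i - 2) * ε))

variable {ε : ℤ}

lemma mono_mul_topMono (hε : ε = 1 ∨ ε = -1) (i : ℤ) :
    mono ε (-2 * ε) * topMono ε i = qPow ε • topMono ε (i - 1) := by
  apply mono_mul_mono_of_eq <;> rcases hε with rfl | rfl <;> ring

lemma mono_neg_mul_topMono (hε : ε = 1 ∨ ε = -1) (i : ℤ) :
    mono (-ε) (2 * ε) * topMono ε i = qPow (-ε) • topMono ε (i + 1) := by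
  apply mono_mul_mono_of_eq <;> rcases hε with rfl | rfl <;> ring

lemma mono_mul_lowMono (hε : ε = 1 ∨ ε = -1) (i : ℤ) :
    mono ε (-2 * ε) * lowMono ε i = qPow (-ε) • lowMono ε (i + 1) := by
  apply mono_mul_mono_of_eq <;> rcases hε with rfl | rfl <;> ring

lemma mono_neg_mul_lowMono (hε : ε = 1 ∨ ε = -1) (i : ℤ) :
    mono (-ε) (2 * ε) * lowMono ε i = qPow ε • lowMono ε (i - 1) := by
  apply mono_mul_mono_of_eq <;> rcases hε with rfl | rfl <;> ring

lemma topMono_mul_lowMono (i : ℤ) : topMono ε i * lowMono ε (i + 1) = 1 := by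
  rw [← mono_zero, ← one_smul QRing (mono 0 0), ← qPow_zero]
  apply mono_mul_mono_of_eq <;> ring

lemma topMono_mem_fst (i : ℤ) : topMono ε i ∈ degLE 2 1 1 := mono_mem_degLE (by linarith)

lemma topMono_mem_snd (hε : ε = 1 ∨ ε = -1) (i : ℤ) :
    topMono ε i ∈ degLE (2 + 2 * ε) 1 (3 - 2 * i) :=
  mono_mem_degLE (by rcases hε with rfl | rfl <;> linarith)

lemma lowMono_mem_fst (i : ℤ) : lowMono ε i ∈ degLE 2 1 (-1) := mono_mem_degLE (by linarith)

lemma lowMono_mem_snd (hε : ε = 1 ∨ ε = -1) (i : ℤ) :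
    lowMono ε i ∈ degLE (2 + 2 * ε) 1 (2 * i - 5) :=
  mono_mem_degLE (by rcases hε with rfl | rfl <;> linarith)

/-- The recursion for even cluster variables respects the shape of their Laurent expansions. -/
lemma shape_step (hε : ε = 1 ∨ ε = -1) {i : ℤ} (hi : 2 ≤ i) {f f' : QTorus}
    (hf : f - topMono ε i - lowMono ε i ∈ lowPart ε (2 * i - 7))
    (hf' : f' - topMono ε (i - 1) - lowMono ε (i - 1) ∈ lowPart ε (2 * i - 5)) :
    (qPow ε • (delta * f) - qPow (2 * ε) • f') - topMono ε (i + 1) - lowMono ε (i + 1) ∈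
      lowPart ε (2 * i - 5) := by
  obtain ⟨g, rfl⟩ : ∃ g, f = topMono ε i + lowMono ε i + g :=
    ⟨f - topMono ε i - lowMono ε i, by abel⟩
  obtain ⟨g', rfl⟩ : ∃ g', f' = topMono ε (i - 1) + lowMono ε (i - 1) + g' :=
    ⟨f' - topMono ε (i - 1) - lowMono ε (i - 1), by abel⟩
  have hg : g ∈ lowPart ε (2 * i - 7) := by
    convert hf using 1
    abel
  have hg' : g' ∈ lowPart ε (2 * i - 5) := by
    convert hf' using 1
    abel
  -- The two monomials of `delta` on the line `2a + b = 0` move `topMono ε i` and `lowMono ε i` one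
  -- index up and one index down. The downward terms cancel against `f'`, the upward ones are the
  -- new extremal terms, and the rest is of lower degree.
  have key : (qPow ε • (delta * (topMono ε i + lowMono ε i + g)) -
      qPow (2 * ε) • (topMono ε (i - 1) + lowMono ε (i - 1) + g')) -
        topMono ε (i + 1) - lowMono ε (i + 1) =
      qPow ε • (mono ε (-2 * ε) * g + mono (-ε) (2 * ε) * g +
        (deltaLow * topMono ε i + deltaLow * (lowMono ε i + g))) - qPow (2 * ε) • g' := by
    rw [delta_eq_add hε]
    simp only [add_mul, mul_add, mono_mul_topMono hε, mono_neg_mul_topMono hε,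
      mono_mul_lowMono hε, mono_neg_mul_lowMono hε, smul_add, smul_smul, ← qPow_add]
    rw [← two_mul, add_neg_cancel, qPow_zero, one_smul, one_smul]
    abel
  have hlow : lowMono ε i + g ∈ lowPart ε (2 * i - 5) :=
    add_mem ⟨lowMono_mem_fst i, lowMono_mem_snd hε i⟩ (lowPart_mono (by linarith) hg)
  have hw1 : mono ε (-2 * ε) ∈ degLE 2 1 0 := mono_mem_degLE (by linarith)
  have hw2 : mono ε (-2 * ε) ∈ degLE (2 + 2 * ε) 1 2 :=
    mono_mem_degLE (by rcases hε with rfl | rfl <;> linarith)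
  have hv1 : mono (-ε) (2 * ε) ∈ degLE 2 1 0 := mono_mem_degLE (by linarith)
  have hv2 : mono (-ε) (2 * ε) ∈ degLE (2 + 2 * ε) 1 2 :=
    mono_mem_degLE (by rcases hε with rfl | rfl <;> linarith)
  rw [key]
  refine sub_mem (Submodule.smul_mem _ _ (add_mem (add_mem ?_ ?_) (add_mem ?_ ?_)))
    (Submodule.smul_mem _ _ hg')
  · exact ⟨mul_mem_degLE hw1 hg.1 (by linarith), mul_mem_degLE hw2 hg.2 (by linarith)⟩
  · exact ⟨mul_mem_degLE hv1 hg.1 (by linarith), mul_mem_degLE hv2 hg.2 (by linarith)⟩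
  · exact ⟨mul_mem_degLE deltaLow_mem_fst (topMono_mem_fst i) (by linarith),
      mul_mem_degLE (deltaLow_mem_snd hε) (topMono_mem_snd hε i) (by linarith)⟩
  · exact ⟨mul_mem_degLE deltaLow_mem_fst hlow.1 (by linarith),
      mul_mem_degLE (deltaLow_mem_snd hε) hlow.2 (by linarith)⟩

/-- The form is `α` times `2a + b` plus twice `(2 + 2ε)a + b`. Its value on `topMono ε i` is `α + 6
- 4i` and on `lowMono ε i` it is `4i - 10 - α`; both are negative exactly in the given range of `α`.
-/
lemma mem_degLE_of_shape (hε : ε = 1 ∨ ε = -1) {i : ℤ} {f : QTorus}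
    (hf : f - topMono ε i - lowMono ε i ∈ lowPart ε (2 * i - 7)) {α : ℤ} (hα : 0 ≤ α)
    (h1 : 4 * i - 10 < α) (h2 : α < 4 * i - 6) :
    f ∈ degLE (2 * α + 2 * (2 + 2 * ε)) (α + 2) (-1) := by
  have hf' : f = topMono ε i + lowMono ε i + (f - topMono ε i - lowMono ε i) := by abel
  rw [hf']
  refine add_mem (add_mem ?_ ?_) ?_
  · exact mem_degLE_of_comb α 2 hα zero_le_two (topMono_mem_fst i) (topMono_mem_snd hε i)
      (by ring) (by ring) (by linarith)
  · exact mem_degLE_of_comb α 2 hα zero_le_two (lowMono_mem_fst i) (lowMono_mem_snd hε i)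
      (by ring) (by ring) (by linarith)
  · exact mem_degLE_of_comb α 2 hα zero_le_two hf.1 hf.2 (by ring) (by ring) (by linarith)

/-- An odd variable is, up to a power of `q`, the product of its even neighbours minus one. That one
is the term `topMono ε i * lowMono ε (i + 1)`. The top-by-top and low-by-low products then determine
the range of `α`. -/
lemma mul_sub_one_mem_degLE_of_shape (hε : ε = 1 ∨ ε = -1) {i : ℤ} {f f' : QTorus}
    (hf : f - topMono ε i - lowMono ε i ∈ lowPart ε (2 * i - 7))
    (hf' : f' - topMono ε (i + 1) - lowMono ε (i + 1) ∈ lowPart ε (2 * i - 5)) {α : ℤ}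
    (hα : 0 ≤ α) (h1 : 4 * i - 8 < α) (h2 : α < 4 * i - 4) :
    f * f' - 1 ∈ degLE (2 * α + 2 * (2 + 2 * ε)) (α + 2) (-1) := by
  obtain ⟨g, rfl⟩ : ∃ g, f = topMono ε i + lowMono ε i + g :=
    ⟨f - topMono ε i - lowMono ε i, by abel⟩
  obtain ⟨g', rfl⟩ : ∃ g', f' = topMono ε (i + 1) + lowMono ε (i + 1) + g' :=
    ⟨f' - topMono ε (i + 1) - lowMono ε (i + 1), by abel⟩
  have hg : g ∈ lowPart ε (2 * i - 7) := by
    convert hf using 1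
    abel
  have hg' : g' ∈ lowPart ε (2 * i - 5) := by
    convert hf' using 1
    abel
  have hlow : lowMono ε i + g ∈ lowPart ε (2 * i - 5) :=
    add_mem ⟨lowMono_mem_fst i, lowMono_mem_snd hε i⟩ (lowPart_mono (by linarith) hg)
  have hlow' : lowMono ε (i + 1) + g' ∈ lowPart ε (2 * i - 3) :=
    add_mem ⟨lowMono_mem_fst _, degLE_mono (by linarith) (lowMono_mem_snd hε _)⟩
      (lowPart_mono (by linarith) hg')
  have key : (topMono ε i + lowMono ε i + g) * (topMono ε (i + 1) + lowMono ε (i + 1) + g') - 1 =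
      topMono ε i * topMono ε (i + 1) + topMono ε i * g' +
        (lowMono ε i + g) * topMono ε (i + 1) +
          (lowMono ε i + g) * (lowMono ε (i + 1) + g') := by
    simp only [add_mul, mul_add, topMono_mul_lowMono]
    abel
  have comb : ∀ {f : QTorus} {N M : ℤ}, f ∈ degLE 2 1 N → f ∈ degLE (2 + 2 * ε) 1 M →
      α * N + 2 * M ≤ -1 → f ∈ degLE (2 * α + 2 * (2 + 2 * ε)) (α + 2) (-1) :=
    fun h h' hN => mem_degLE_of_comb α 2 hα zero_le_two h h' (by ring) (by ring) hN
  rw [key]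
  refine add_mem (add_mem (add_mem ?_ ?_) ?_) ?_
  · exact comb (mul_mem_degLE (topMono_mem_fst _) (topMono_mem_fst _) le_rfl)
      (mul_mem_degLE (topMono_mem_snd hε _) (topMono_mem_snd hε _) le_rfl) (by linarith)
  · exact comb (mul_mem_degLE (topMono_mem_fst _) hg'.1 le_rfl)
      (mul_mem_degLE (topMono_mem_snd hε _) hg'.2 le_rfl) (by linarith)
  · exact comb (mul_mem_degLE hlow.1 (topMono_mem_fst _) le_rfl)
      (mul_mem_degLE hlow.2 (topMono_mem_snd hε _) le_rfl) (by linarith)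
  · exact comb (mul_mem_degLE hlow.1 hlow'.1 le_rfl)
      (mul_mem_degLE hlow.2 hlow'.2 le_rfl) (by linarith)

end QTorus

/-! ### Expansions of a cluster sequence in `x 1` and `x 2`. -/

namespace IsClusterSeq

variable {R : Type*} [DivisionRing R] [Algebra QRing R] {x : ℤ → R} {d : R}
  (h : IsClusterSeq x d)

/-- The homomorphism from the quantum torus that belongs to the cluster `{x 1, x 2}`. -/
def laurent : QTorus →ₐ[QRing] R :=
  laurentHom (x 1) (x 2) (h.ne_zero 1) (h.ne_zero 2) (h.comm 1)

lemma laurent_mono (a b : ℤ) :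
    h.laurent (mono a b) = qPow (-(a * b)) • (x 1 ^ a * x 2 ^ b) := laurentHom_mono _ _ _ a b

lemma laurent_one_zero : h.laurent (mono 1 0) = x 1 := by
  rw [laurent_mono]
  simp [qPow_zero]

lemma laurent_zero_one : h.laurent (mono 0 1) = x 2 := by
  rw [laurent_mono]
  simp [qPow_zero]

lemma laurent_three : h.laurent (mono (-1) 0 + mono (-1) 4) = x 3 := by
  apply mul_left_cancel₀ (h.ne_zero 1)
  have h1 := h.exch_even 2 even_two
  norm_num at h1
  rw [h1, ← h.laurent_one_zero, ← h.laurent_zero_one, ← map_mul, ← map_pow, mul_add,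
    mono_mul_mono_of_eq (r := 0) (e := 0) (f := 0), mono_mul_mono_of_eq (r := 4) (e := 0) (f := 4),
    mono_pow, map_add, map_smul, map_smul, mono_zero, map_one, qPow_zero_smul, add_comm]
  all_goals norm_num

lemma laurent_delta : h.laurent QTorus.delta = d := by
  apply mul_left_cancel₀ (h.ne_zero 2)
  apply mul_right_cancel₀ (h.ne_zero 2)
  have h1 := h.delta 2 even_two
  norm_num at h1
  rw [h1, ← h.laurent_zero_one, ← h.laurent_one_zero, ← h.laurent_three, ← map_mul, ← map_mul,
    mono_mul_delta_mul_mono, map_add, map_add, map_add h.laurent (qPow 1 • 1), map_smul, map_smul,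
    map_one]

lemma laurent_four : h.laurent (mono (-1) 3 + mono 0 (-1) + mono (-1) (-1)) = x 4 := by
  apply mul_left_cancel₀ (h.ne_zero 2)
  have h1 := h.exch_odd 3 (by decide)
  norm_num at h1
  rw [h1, ← h.laurent_zero_one, ← h.laurent_three, ← map_mul, ← map_smul, ← map_one h.laurent,
    ← map_add]
  congr 1
  simp only [mul_add, mono_mul_mono, smul_add]
  norm_num [qPow_zero, mono_zero]
  abel

lemma laurent_zero : h.laurent (mono 1 (-1) + mono 0 (-1)) = x 0 := by
  apply mul_right_cancel₀ (h.ne_zero 2)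
  have h1 := h.exch_odd 1 odd_one
  norm_num at h1
  rw [h1, ← h.laurent_zero_one, ← h.laurent_one_zero, ← map_mul, ← map_smul,
    ← map_one h.laurent, ← map_add]
  congr 1
  simp only [add_mul, mono_mul_mono]
  norm_num [qPow_zero, mono_zero]

/-- The Laurent expansions of the even cluster variables. -/
lemma exists_shape {ε : ℤ} (hε : ε = 1 ∨ ε = -1) {i : ℕ} (hi : 2 ≤ i) :
    (∃ f, h.laurent f = x (2 + 2 * ε * (i - 1)) ∧
      f - topMono ε i - lowMono ε i ∈ lowPart ε (2 * i - 7)) ∧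
    ∃ f, h.laurent f = x (2 + 2 * ε * (i - 2)) ∧
      f - topMono ε (i - 1) - lowMono ε (i - 1) ∈ lowPart ε (2 * i - 5) := by
  induction i, hi using Nat.le_induction with
  | base =>
    constructor
    · rcases hε with rfl | rfl
      · refine ⟨_, h.laurent_four, ?_⟩
        have h1 : mono (-1) (-1) ∈ lowPart 1 (-3) :=
          ⟨mono_mem_degLE (by norm_num), mono_mem_degLE (by norm_num)⟩
        norm_num [topMono, lowMono]
        convert h1 using 1
        abel
      · refine ⟨_, h.laurent_zero, ?_⟩
        norm_num [topMono, lowMono]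
    -- The expansion of `x 2` lacks the term `lowMono ε 1`, which therefore enters the remainder
    -- with a minus sign. This is why the bound for the preceding variable is weaker than the one
    -- for the current variable.
    · refine ⟨mono 0 1, by rw [laurent_zero_one]; norm_num, ?_⟩
      norm_num [topMono, lowMono]
      rcases hε with rfl | rfl <;>
        exact ⟨mono_mem_degLE (by norm_num), mono_mem_degLE (by norm_num)⟩
  | succ i hi ih =>
    obtain ⟨⟨f, hf, hfs⟩, f', hf', hfs'⟩ := ih
    have hi' : (2 : ℤ) ≤ i := by exact_mod_cast hi
    refine ⟨⟨qPow ε • (QTorus.delta * f) - qPow (2 * ε) • f', ?_, ?_⟩, f, ?_, ?_⟩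
    · have hk : Even (2 + 2 * ε * ((i : ℤ) - 1)) :=
        even_two.add ((even_two_mul ε).mul_right _)
      have h1 := h.delta_mul_even hk
      rw [map_sub, map_smul, map_smul, map_mul, h.laurent_delta, hf, hf', h1]
      rcases hε with rfl | rfl
      · rw [show (2 : ℤ) + 2 * 1 * (i - 1) - 2 = 2 + 2 * 1 * (i - 2) by ring,
          show (2 : ℤ) + 2 * 1 * (i - 1) + 2 = 2 + 2 * 1 * (((i + 1 : ℕ) : ℤ) - 1) by
            push_cast; ring]
        simp only [smul_add, qPow_smul_qPow_smul]
        norm_num [qPow_zero_smul]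
      · rw [show (2 : ℤ) + 2 * (-1) * (i - 1) + 2 = 2 + 2 * (-1) * (i - 2) by ring,
          show (2 : ℤ) + 2 * (-1) * (i - 1) - 2 = 2 + 2 * (-1) * (((i + 1 : ℕ) : ℤ) - 1) by
            push_cast; ring]
        simp only [smul_add, qPow_smul_qPow_smul]
        norm_num [qPow_zero_smul]
    · rw [Nat.cast_succ, show 2 * ((i : ℤ) + 1) - 7 = 2 * i - 5 by ring]
      exact shape_step hε hi' hfs hfs'
    · rw [hf]
      congr 1
      push_cast
      ring
    · convert lowPart_mono (show 2 * (i : ℤ) - 7 ≤ 2 * ((i + 1 : ℕ) : ℤ) - 5 by push_cast; linarith)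
        hfs using 2
      · push_cast
        ring_nf
      · push_cast
        ring_nf

lemma exists_even_mem_degLE {ε : ℤ} (hε : ε = 1 ∨ ε = -1) {i : ℕ} (hi : 2 ≤ i) {α : ℤ}
    (hα : 0 ≤ α) (h1 : 4 * (i : ℤ) - 10 < α) (h2 : α < 4 * (i : ℤ) - 6) {k : ℤ}
    (hk : k = 2 + 2 * ε * (i - 1)) :
    ∃ f, h.laurent f = x k ∧ f ∈ degLE (2 * α + 2 * (2 + 2 * ε)) (α + 2) (-1) := by
  obtain ⟨⟨f, hf, hfs⟩, -⟩ := h.exists_shape hε hi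
  exact ⟨f, hk ▸ hf, mem_degLE_of_shape hε hfs hα h1 h2⟩

lemma exists_odd_mem_degLE {ε : ℤ} (hε : ε = 1 ∨ ε = -1) {i : ℕ} (hi : 2 ≤ i) {α : ℤ}
    (hα : 0 ≤ α) (h1 : 4 * (i : ℤ) - 8 < α) (h2 : α < 4 * (i : ℤ) - 4) {k : ℤ}
    (hk : k = 2 + 2 * ε * (i - 1) + ε) :
    ∃ f, h.laurent f = x k ∧ f ∈ degLE (2 * α + 2 * (2 + 2 * ε)) (α + 2) (-1) := by
  obtain ⟨⟨f, hf, hfs⟩, -⟩ := h.exists_shape hε hi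
  obtain ⟨⟨f', hf', hfs'⟩, -⟩ := h.exists_shape hε (hi.trans i.le_succ)
  have hk' : Odd k := by
    rw [hk]
    refine (even_two.add ((even_two_mul ε).mul_right _)).add_odd ?_
    rcases hε with rfl | rfl <;> decide
  refine ⟨qPow (-ε) • (f * f' - 1), ?_, Submodule.smul_mem _ _
    (mul_sub_one_mem_degLE_of_shape hε hfs ?_ hα h1 h2)⟩
  · rw [map_smul, map_sub, map_mul, map_one, hf, hf', eq_comm, eq_qPow_smul_iff, neg_neg,
      sub_eq_iff_eq_add]
    rcases hε with rfl | rfl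
    · rw [← h.exch_odd k hk', hk]
      congr 2
      · ring
      · push_cast
        ring
    · rw [← h.exch_odd_rev hk', hk]
      congr 2
      · ring
      · push_cast
        ring
  · rw [Nat.cast_succ, show 2 * ((i : ℤ) + 1) - 7 = 2 * i - 5 by ring] at hfs'
    exact hfs'

lemma exists_mem_degLE_right {k : ℤ} (hk : 4 ≤ k) : ∃ α : ℤ, 1 ≤ α ∧ ∃ f g,
    h.laurent f = x k ∧ h.laurent g = x (k + 1) ∧ f ∈ degLE (2 * α + 8) (α + 2) (-1) ∧
      g ∈ degLE (2 * α + 8) (α + 2) (-1) := by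
  obtain ⟨i, hi | hi⟩ : ∃ i : ℕ, k = 2 * i ∨ k = 2 * i + 1 := ⟨(k / 2).toNat, by omega⟩
  -- One `α` must serve both variables of the cluster: `4i - 7` is the only integer common to the
  -- ranges for the `i`-th even variable and the odd one after it. In the other case the ranges of
  -- that odd variable and the next even one meet in `4i - 5`.
  · obtain ⟨f, hf, hfs⟩ := h.exists_even_mem_degLE (Or.inl rfl) (i := i) (by omega)
      (α := 4 * i - 7) (by omega) (by omega) (by omega) (k := k) (by omega)
    obtain ⟨g, hg, hgs⟩ := h.exists_odd_mem_degLE (Or.inl rfl) (i := i) (by omega)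
      (α := 4 * i - 7) (by omega) (by omega) (by omega) (k := k + 1) (by omega)
    exact ⟨4 * i - 7, by omega, f, g, hf, hg, hfs, hgs⟩
  · obtain ⟨f, hf, hfs⟩ := h.exists_odd_mem_degLE (Or.inl rfl) (i := i) (by omega)
      (α := 4 * i - 5) (by omega) (by omega) (by omega) (k := k) (by omega)
    obtain ⟨g, hg, hgs⟩ := h.exists_even_mem_degLE (Or.inl rfl) (i := i + 1) (by omega)
      (α := 4 * i - 5) (by omega) (by omega) (by omega) (k := k + 1) (by omega)
    exact ⟨4 * i - 5, by omega, f, g, hf, hg, hfs, hgs⟩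

lemma exists_mem_degLE_left {k : ℤ} (hk : k ≤ -1) : ∃ α : ℤ, 1 ≤ α ∧ ∃ f g,
    h.laurent f = x k ∧ h.laurent g = x (k + 1) ∧ f ∈ degLE (2 * α) (α + 2) (-1) ∧
      g ∈ degLE (2 * α) (α + 2) (-1) := by
  obtain ⟨i, hi | hi⟩ : ∃ i : ℕ, k = 3 - 2 * i ∨ k = 2 - 2 * i := ⟨((3 - k) / 2).toNat, by omega⟩
  · obtain ⟨f, hf, hfs⟩ := h.exists_odd_mem_degLE (Or.inr rfl) (i := i) (by omega)
      (α := 4 * i - 7) (by omega) (by omega) (by omega) (k := k) (by omega)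
    obtain ⟨g, hg, hgs⟩ := h.exists_even_mem_degLE (Or.inr rfl) (i := i) (by omega)
      (α := 4 * i - 7) (by omega) (by omega) (by omega) (k := k + 1) (by omega)
    refine ⟨4 * i - 7, by omega, f, g, hf, hg, ?_, ?_⟩
    · simpa using hfs
    · simpa using hgs
  · obtain ⟨f, hf, hfs⟩ := h.exists_even_mem_degLE (Or.inr rfl) (i := i + 1) (by omega)
      (α := 4 * i - 5) (by omega) (by omega) (by omega) (k := k) (by omega)
    obtain ⟨g, hg, hgs⟩ := h.exists_odd_mem_degLE (Or.inr rfl) (i := i) (by omega)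
      (α := 4 * i - 5) (by omega) (by omega) (by omega) (k := k + 1) (by omega)
    refine ⟨4 * i - 5, by omega, f, g, hf, hg, ?_, ?_⟩
    · simpa using hfs
    · simpa using hgs

lemma laurent_monomial {f g : QTorus} {u v : R} (hf : h.laurent f = u) (hg : h.laurent g = v)
    (r : ℤ) (a b : ℕ) : h.laurent (qPow r • (f ^ a * g ^ b)) = qPow r • (u ^ a * v ^ b) := by
  rw [map_smul, map_mul, map_pow, map_pow, hf, hg]

lemma laurent_mono_natCast (a b : ℕ) :
    h.laurent (mono a b) = qPow (-(a * b)) • (x 1 ^ a * x 2 ^ b) := by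
  rw [laurent_mono, zpow_natCast, zpow_natCast]

/-- The Laurent expansions of cluster monomials avoid the first quadrant. -/
theorem exists_quadrantFree (k : ℤ) (a b : ℕ) :
    ∃ f, h.laurent f = qPow (-(a * b)) • (x k ^ a * x (k + 1) ^ b) ∧ QuadrantFree f := by
  obtain hk | rfl | rfl | rfl | rfl | hk : k ≤ -1 ∨ k = 0 ∨ k = 1 ∨ k = 2 ∨ k = 3 ∨ 4 ≤ k := by
    omega
  · obtain ⟨α, hα, f, g, hf, hg, hfs, hgs⟩ := h.exists_mem_degLE_left hk
    exact ⟨_, h.laurent_monomial hf hg _ a b,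
      quadrantFree_monomial (by linarith) (by linarith) hfs hgs a b⟩
  · rcases a with _ | a
    · refine ⟨mono b 0, ?_, by simpa using quadrantFree_mono b 0⟩
      have := h.laurent_mono_natCast b 0
      simpa using this
    · refine ⟨_, h.laurent_monomial h.laurent_zero h.laurent_one_zero _ (a + 1) b, ?_⟩
      have h0 : mono 1 (-1) + mono 0 (-1) ∈ degLE 0 1 (-1) :=
        add_mem (mono_mem_degLE (by norm_num)) (mono_mem_degLE (by norm_num))
      have h1 : mono 1 0 ∈ degLE 0 1 0 := mono_mem_degLE (by norm_num)
      exact quadrantFree_of_mem_degLE le_rfl zero_le_one (Submodule.smul_mem _ _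
        (mul_mem_degLE (pow_mem_degLE h0 (a + 1)) (pow_mem_degLE h1 b) (by push_cast; linarith)))
  · exact ⟨mono a b, h.laurent_mono_natCast a b, quadrantFree_mono a b⟩
  · rcases b with _ | b
    · refine ⟨mono 0 a, ?_, by simpa using quadrantFree_mono 0 a⟩
      have := h.laurent_mono_natCast 0 a
      simpa using this
    · refine ⟨_, h.laurent_monomial h.laurent_zero_one h.laurent_three _ a (b + 1), ?_⟩
      have h0 : mono (-1) 0 + mono (-1) 4 ∈ degLE 1 0 (-1) :=
        add_mem (mono_mem_degLE (by norm_num)) (mono_mem_degLE (by norm_num))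
      have h1 : mono 0 1 ∈ degLE 1 0 0 := mono_mem_degLE (by norm_num)
      exact quadrantFree_of_mem_degLE zero_le_one le_rfl (Submodule.smul_mem _ _
        (mul_mem_degLE (pow_mem_degLE h1 a) (pow_mem_degLE h0 (b + 1)) (by push_cast; linarith)))
  -- The form `6a + b` is negative on all five exponents of `x 3` and `x 4`.
  · refine ⟨_, h.laurent_monomial h.laurent_three h.laurent_four _ a b,
      quadrantFree_monomial (u := 6) (v := 1) (by norm_num) (by norm_num) ?_ ?_ a b⟩
    · exact add_mem (mono_mem_degLE (by norm_num)) (mono_mem_degLE (by norm_num))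
    · exact add_mem (add_mem (mono_mem_degLE (by norm_num)) (mono_mem_degLE (by norm_num)))
        (mono_mem_degLE (by norm_num))
  · obtain ⟨α, hα, f, g, hf, hg, hfs, hgs⟩ := h.exists_mem_degLE_right hk
    exact ⟨_, h.laurent_monomial hf hg _ a b,
      quadrantFree_monomial (by linarith) (by linarith) hfs hgs a b⟩

/-- The Laurent expansions of cluster monomials avoid the ray through `(1, -2)`, if the cluster is
far to the right. -/
theorem exists_coeff_ray_eq_zero {k : ℤ} (hk : 4 ≤ k) (a b : ℕ) :
    ∃ f, h.laurent f = qPow (-(a * b)) • (x k ^ a * x (k + 1) ^ b) ∧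
      ∀ n : ℕ, 1 ≤ n → f.coeff (n, -2 * n) = 0 := by
  obtain ⟨α, hα, f, g, hf, hg, hfs, hgs⟩ := h.exists_mem_degLE_right hk
  refine ⟨_, h.laurent_monomial hf hg _ a b, fun n hn => ?_⟩
  -- At `(n, -2n)` the form takes the value `n (2α + 8) - 2n (α + 2) = 4n > 0`, whereas on the
  -- monomial it is at most `-(a + b) ≤ 0`.
  refine coeff_eq_zero_of_mem_degLE (monomial_mem_degLE hfs hgs _ a b) ?_
  have h1 : (1 : ℤ) ≤ n := by exact_mod_cast hn
  simp only
  nlinarith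

end IsClusterSeq

/-! ### The elements `F_n(X_δ)` -/

namespace QTorus

/-- The part of `F_n(X_δ)` on the line `2a + b = 0`. -/
def lineMono (n : ℤ) : QTorus := mono n (-2 * n) + mono (-n) (2 * n)

/-- Monomials with exponents on one line through the origin commute, so `lineMono n` behaves like
`z^n + z^{-n}` and satisfies the Chebyshev recursion. -/
lemma lineMono_mul_lineMono_one (n : ℤ) :
    lineMono n * lineMono 1 = lineMono (n + 1) + lineMono (n - 1) := by
  simp only [lineMono, mul_add, add_mul, mono_mul_mono]
  ring_nf
  rw [qPow_zero]
  simp only [one_smul]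
  abel

lemma delta_sub_lineMono : delta - lineMono 1 = deltaLow := by
  rw [delta_eq_add (Or.inl rfl), lineMono]
  norm_num

lemma lineMono_mem (n : ℤ) : lineMono n ∈ degLE 2 1 0 :=
  add_mem (mono_mem_degLE (by linarith)) (mono_mem_degLE (by linarith))

/-- `F_n(X_δ)` in the quantum torus. -/
def chebDelta (n : ℕ) : QTorus := Polynomial.aeval delta (chebF n)

lemma chebDelta_zero : chebDelta 0 = 1 := by rw [chebDelta, chebF, map_one]

lemma chebDelta_one : chebDelta 1 = delta := by rw [chebDelta, chebF, Polynomial.aeval_X]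

lemma chebDelta_two : chebDelta 2 = delta * delta - 2 := by
  rw [chebDelta, chebF, map_sub, map_pow, Polynomial.aeval_X, sq, map_ofNat]

lemma chebDelta_add_three (n : ℕ) :
    chebDelta (n + 3) = chebDelta (n + 2) * delta - chebDelta (n + 1) := by
  simp only [chebDelta]
  rw [chebF, map_sub, map_mul, Polynomial.aeval_X]

lemma lineMono_zero : lineMono 0 = 2 := by
  rw [lineMono]
  norm_num [mono_zero]

lemma mul_delta_sub_mem {f g : QTorus} {n : ℤ} (hf : f - lineMono n ∈ degLE 2 1 (-1))
    (hg : g - lineMono (n - 1) ∈ degLE 2 1 (-1)) :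
    f * delta - g - lineMono (n + 1) ∈ degLE 2 1 (-1) := by
  have key : f * delta - g - lineMono (n + 1) = (f - lineMono n) * lineMono 1 +
      (f - lineMono n) * deltaLow + lineMono n * deltaLow - (g - lineMono (n - 1)) := by
    rw [eq_sub_of_add_eq (lineMono_mul_lineMono_one n).symm, ← delta_sub_lineMono]
    simp only [sub_mul, mul_sub]
    abel
  rw [key]
  exact sub_mem (add_mem (add_mem (mul_mem_degLE hf (lineMono_mem 1) (by norm_num))
    (mul_mem_degLE hf deltaLow_mem_fst (by norm_num)))
    (mul_mem_degLE (lineMono_mem n) deltaLow_mem_fst (by norm_num))) hg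

/-- Modulo degree `-1` for `2a + b`, `delta` is `lineMono 1`, so `F_n(delta)` is `lineMono n`. For
`n = 2` the constant in `F_2` matches `lineMono 0 = 2`. -/
lemma chebDelta_sub_lineMono_mem (n : ℕ) :
    chebDelta (n + 1) - lineMono (n + 1) ∈ degLE 2 1 (-1) ∧
      chebDelta (n + 2) - lineMono (n + 2) ∈ degLE 2 1 (-1) := by
  have h1 : delta - lineMono 1 ∈ degLE 2 1 (-1) := by
    rw [delta_sub_lineMono]
    exact degLE_mono (by norm_num) deltaLow_mem_fst
  induction n with
  | zero =>
    simp only [zero_add, CharP.cast_eq_zero, chebDelta_one, chebDelta_two]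
    refine ⟨h1, ?_⟩
    have h2 : (2 : QTorus) - lineMono (1 - 1) ∈ degLE 2 1 (-1) := by
      rw [sub_self, lineMono_zero, sub_self]
      exact zero_mem _
    simpa using mul_delta_sub_mem h1 h2
  | succ n ih =>
    have h2 := mul_delta_sub_mem (n := n + 2) ih.2 (by
      rw [show (n : ℤ) + 2 - 1 = n + 1 by ring]
      exact ih.1)
    refine ⟨?_, ?_⟩
    · push_cast
      rw [add_assoc (n : ℤ)]
      exact ih.2
    · rw [add_right_comm, chebDelta_add_three]
      push_cast
      rw [show (n : ℤ) + 1 + 2 = n + 2 + 1 by ring]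
      exact h2

lemma chebDelta_coeff {n : ℕ} (hn : 1 ≤ n) {m : ℤ × ℤ} (hm : 0 ≤ 2 * m.1 + m.2) :
    (chebDelta n).coeff m = (lineMono n).coeff m := by
  obtain ⟨n, rfl⟩ : ∃ k, n = k + 1 := ⟨n - 1, by omega⟩
  have h1 := coeff_eq_zero_of_mem_degLE (chebDelta_sub_lineMono_mem n).1 (m := m) (by linarith)
  rw [coeff_sub, sub_eq_zero] at h1
  exact_mod_cast h1

/-- The half-plane `2a + b ≤ 0` meets the first quadrant only in the origin, and `lineMono n` has no
constant term for `n ≥ 1`. -/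
lemma quadrantFree_chebDelta (n : ℕ) : QuadrantFree (chebDelta n) := by
  rcases n with _ | n
  · rw [chebDelta_zero, ← mono_zero]
    exact quadrantFree_mono 0 0
  · intro i j
    left
    rw [chebDelta_coeff (by omega) (by simp only; omega), lineMono, coeff_add, coeff_mono,
      coeff_mono, if_neg, if_neg, add_zero]
    all_goals
      rw [Prod.mk.injEq]
      push_cast
      omega

lemma chebDelta_coeff_ray {j n : ℕ} (hn : 1 ≤ n) :
    (chebDelta j).coeff (n, -2 * n) = if j = n then 1 else 0 := by
  rcases j with _ | j
  · rw [chebDelta_zero, ← mono_zero, coeff_mono, if_neg, if_neg]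
    · omega
    · rw [Prod.mk.injEq]
      omega
  · rw [chebDelta_coeff (by omega) (by simp only; omega), lineMono, coeff_add, coeff_mono,
      coeff_mono]
    have h1 : ¬ ((-((j + 1 : ℕ) : ℤ), 2 * ((j + 1 : ℕ) : ℤ)) = ((n : ℤ), -2 * (n : ℤ))) := by
      rw [Prod.mk.injEq]
      push_cast
      omega
    rw [if_neg h1, add_zero]
    congr 1
    rw [Prod.mk.injEq, eq_iff_iff]
    push_cast
    omega

end QTorus

lemma IsClusterSeq.laurent_chebDelta {R : Type*} [DivisionRing R] [Algebra QRing R] [Algebra ℤ R]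
    {x : ℤ → R} {d : R} (h : IsClusterSeq x d) (n : ℕ) :
    h.laurent (chebDelta n) = Polynomial.aeval d (chebF n) := by
  have h1 := Polynomial.hom_eval₂ (chebF n) (algebraMap ℤ QTorus) (h.laurent : QTorus →+* R)
    QTorus.delta
  rw [AlgHom.coe_toRingHom, h.laurent_delta,
    RingHom.ext_int ((h.laurent : QTorus →+* R).comp (algebraMap ℤ QTorus)) (algebraMap ℤ R)] at h1
  exact h1

/-! ### Extraction of coefficients -/

lemma laurentHom_congr {R : Type*} [DivisionRing R] [Algebra QRing R] {u v u' v' : R}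
    (hu : u ≠ 0) (hv : v ≠ 0) (h : u * v = qPow 2 • (v * u)) (hu' : u' ≠ 0) (hv' : v' ≠ 0)
    (h' : u' * v' = qPow 2 • (v' * u')) (e : u = u') (e' : v = v') :
    laurentHom u v hu hv h = laurentHom u' v' hu' hv' h' := by
  subst e e'
  rfl

lemma algebraMap_qFrac_injective : Function.Injective (algebraMap QRing QFrac) := by
  rw [injective_iff_map_eq_zero]
  intro c hc
  rw [Algebra.algebraMap_eq_smul_one] at hc
  exact smul_eq_zero_imp hc one_ne_zero

/-- The embedding of the quantum torus that belongs to the cluster `{X_m, X_{m+1}}`. -/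
def clusterHom (m : ℤ) : QTorus →ₐ[QRing] QFrac :=
  laurentHom (clusterVar m) (clusterVar (m + 1)) (clusterVar_ne_zero m)
    (clusterVar_ne_zero (m + 1)) (isClusterSeq_clusterVar.comm m)

lemma clusterHom_mono (m a b : ℤ) : clusterHom m (mono a b) = clusterMono m a b :=
  laurentHom_mono _ _ _ a b

lemma clusterHom_injective (m : ℤ) : Function.Injective (clusterHom m) :=
  torus_algHom_injective _ algebraMap_qFrac_injective

lemma op_aeval {R : Type*} [Ring R] [Algebra ℤ R] (d : R) (p : Polynomial ℤ) :
    MulOpposite.op (Polynomial.aeval d p) = Polynomial.aeval (MulOpposite.op d) p := by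
  induction p using Polynomial.induction_on' with
  | add p q hp hq => rw [map_add, map_add, MulOpposite.op_add, hp, hq]
  | monomial n c =>
    rw [Polynomial.aeval_monomial, Polynomial.aeval_monomial, eq_intCast, eq_intCast,
      (Int.cast_commute c _).eq, MulOpposite.op_mul, MulOpposite.op_intCast, MulOpposite.op_pow]

/-! ### Reduction of every cluster to `{x 1, x 2}`. -/

section OddCluster

variable {m : ℤ} (hm : Odd m)
include hm

lemma isClusterSeq_shift : IsClusterSeq (fun k => clusterVar (k + (m - 1))) Xdelta :=
  isClusterSeq_clusterVar.shift (hm.sub_odd odd_one)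

lemma laurent_shift_eq : (isClusterSeq_shift hm).laurent = clusterHom m :=
  laurentHom_congr _ _ _ _ _ _ (congrArg clusterVar (by ring)) (congrArg clusterVar (by ring))

omit hm in
lemma clusterMono_eq_shift (m k : ℤ) (a b : ℕ) : clusterMono k a b =
    qPow (-(a * b)) • (clusterVar (k - (m - 1) + (m - 1)) ^ a *
      clusterVar (k - (m - 1) + 1 + (m - 1)) ^ b) := by
  rw [clusterMono_natCast, sub_add_cancel, add_right_comm, sub_add_cancel]

lemma clusterHom_chebDelta (n : ℕ) :
    clusterHom m (chebDelta n) = Polynomial.aeval Xdelta (chebF n) := by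
  rw [← laurent_shift_eq hm]
  exact (isClusterSeq_shift hm).laurent_chebDelta n

lemma exists_quadrantFree_odd {Z : QFrac} (hZ : Z ∈ basisB) :
    ∃ f, clusterHom m f = Z ∧ QuadrantFree f := by
  rcases hZ with ⟨k, a, b, rfl⟩ | ⟨n, rfl⟩
  · obtain ⟨f, hf, hfq⟩ := (isClusterSeq_shift hm).exists_quadrantFree (k - (m - 1)) a b
    rw [laurent_shift_eq hm] at hf
    exact ⟨f, hf.trans (clusterMono_eq_shift m k a b).symm, hfq⟩
  · exact ⟨_, clusterHom_chebDelta hm n, quadrantFree_chebDelta n⟩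

end OddCluster

section EvenCluster

variable {m : ℤ} (hm : Even m)
include hm

/-- The reflection `k ↦ m + 2 - k` preserves parity for even `m` and puts `X_{m+1}`, `X_m` in the
places `1`, `2`; hence the exchange of exponents by `swap`. -/
lemma isClusterSeq_op : IsClusterSeq
    (fun k => MulOpposite.op (clusterVar (-(k + (-m - 2))))) (MulOpposite.op Xdelta) :=
  isClusterSeq_clusterVar.op.shift (hm.neg.sub even_two)

lemma clusterHom_swap (f : QTorus) :
    MulOpposite.op (clusterHom m (swap f)) = (isClusterSeq_op hm).laurent f := by
  induction f using QTorus.induction with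
  | h0 => simp
  | hadd f g hf hg => rw [map_add, map_add, map_add, MulOpposite.op_add, hf, hg]
  | ht e c =>
    rw [term_eq_smul_mono, map_smul, map_smul, map_smul, MulOpposite.op_smul, swap_mono,
      clusterHom_mono, IsClusterSeq.laurent_mono, clusterMono, MulOpposite.op_smul,
      MulOpposite.op_mul, MulOpposite.op_zpow, MulOpposite.op_zpow, mul_comm e.2,
      show -((1 : ℤ) + (-m - 2)) = m + 1 by ring, show -((2 : ℤ) + (-m - 2)) = m by ring]

lemma exists_quadrantFree_even {Z : QFrac} (hZ : Z ∈ basisB) :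
    ∃ f, clusterHom m f = Z ∧ QuadrantFree f := by
  obtain ⟨f, hf, hfq⟩ : ∃ f, (isClusterSeq_op hm).laurent f = MulOpposite.op Z ∧
      QuadrantFree f := by
    rcases hZ with ⟨k, a, b, rfl⟩ | ⟨n, rfl⟩
    · obtain ⟨f, hf, hfq⟩ := (isClusterSeq_op hm).exists_quadrantFree (m + 1 - k) b a
      refine ⟨f, hf.trans ?_, hfq⟩
      rw [clusterMono_natCast, MulOpposite.op_smul, MulOpposite.op_mul, MulOpposite.op_pow,
        MulOpposite.op_pow, mul_comm (b : ℤ), show -(m + 1 - k + (-m - 2)) = k + 1 by ring,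
        show -(m + 1 - k + 1 + (-m - 2)) = k by ring]
    · exact ⟨_, ((isClusterSeq_op hm).laurent_chebDelta n).trans (op_aeval _ _).symm,
        quadrantFree_chebDelta n⟩
  refine ⟨swap f, MulOpposite.op_injective ((clusterHom_swap hm f).trans hf), fun i j => ?_⟩
  rw [coeff_swap]
  refine (hfq j i).imp id fun h => ?_
  rw [h, swap_mono]

end EvenCluster

/-! ### Separation of basis elements by coefficients, and the conclusion. -/

lemma exists_clusterHom_quadrantFree (m : ℤ) {Z : QFrac} (hZ : Z ∈ basisB) :
    ∃ f, clusterHom m f = Z ∧ QuadrantFree f :=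
  (Int.even_or_odd m).elim (fun hm => exists_quadrantFree_even hm hZ)
    fun hm => exists_quadrantFree_odd hm hZ

lemma exists_coeff_ray {n : ℕ} (hn : 1 ≤ n) {Z : QFrac} (hZ : Z ∈ basisB) :
    ∃ N : ℤ, ∀ m ≤ N, Odd m → ∃ f, clusterHom m f = Z ∧
      (f.coeff (n, -2 * n) = 0 ∨ Z = Polynomial.aeval Xdelta (chebF n)) := by
  rcases hZ with ⟨k, a, b, rfl⟩ | ⟨j, rfl⟩
  -- For `m ≤ k - 3` the shifted index `k - (m - 1)` is at least `4`, as `exists_coeff_ray_eq_zero`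
  -- requires.
  · refine ⟨k - 3, fun m hmk hm => ?_⟩
    obtain ⟨f, hf, hfq⟩ := (isClusterSeq_shift hm).exists_coeff_ray_eq_zero
      (k := k - (m - 1)) (by linarith) a b
    rw [laurent_shift_eq hm] at hf
    exact ⟨f, hf.trans (clusterMono_eq_shift m k a b).symm, Or.inl (hfq n hn)⟩
  · refine ⟨0, fun m _ hm => ⟨_, clusterHom_chebDelta hm j, ?_⟩⟩
    by_cases hj : j = n
    · exact Or.inr (hj ▸ rfl)
    · rw [chebDelta_coeff_ray hn, if_neg hj]
      exact Or.inl rfl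

/-- A coefficient of a Laurent expansion that separates `Z` from finitely many other elements. -/
lemma exists_separating {Z : QFrac} (hZ : Z ∈ basisB) (S : Finset QFrac)
    (hS : ∀ W ∈ S, W ∈ basisB) : ∃ (m : ℤ) (e : ℤ × ℤ),
      (∃ f, clusterHom m f = Z ∧ f.coeff e = 1) ∧
        ∀ W ∈ S, W ≠ Z → ∃ f, clusterHom m f = W ∧ f.coeff e = 0 := by
  have mono_case : ∀ (m : ℤ) (a b : ℕ), Z = clusterMono m a b → ∃ (m : ℤ) (e : ℤ × ℤ),
      (∃ f, clusterHom m f = Z ∧ f.coeff e = 1) ∧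
        ∀ W ∈ S, W ≠ Z → ∃ f, clusterHom m f = W ∧ f.coeff e = 0 := by
    rintro m a b rfl
    refine ⟨m, (a, b), ⟨mono a b, clusterHom_mono m a b, coeff_mono_self _ _⟩, fun W hW hne => ?_⟩
    obtain ⟨f, hf, hfq⟩ := exists_clusterHom_quadrantFree m (hS W hW)
    refine ⟨f, hf, (hfq a b).resolve_right fun h => hne ?_⟩
    rw [← hf, h, clusterHom_mono]
  rcases hZ with ⟨m, a, b, h⟩ | ⟨n, rfl⟩
  · exact mono_case m a b h
  · rcases Nat.eq_zero_or_pos n with rfl | hn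
    -- `F_0(X_δ) = 1` is itself a cluster monomial.
    · refine mono_case 0 0 0 ?_
      rw [chebF, map_one, ← clusterHom_mono]
      exact (map_one _).symm
    · have h1 : ∀ W : S, ∃ N : ℤ, ∀ m ≤ N, Odd m → ∃ f, clusterHom m f = W ∧
          (f.coeff (n, -2 * n) = 0 ∨ (W : QFrac) = Polynomial.aeval Xdelta (chebF n)) :=
        fun W => exists_coeff_ray hn (hS W W.2)
      choose N hN using h1
      obtain ⟨M, hM⟩ := (Finset.univ.image fun W => -N W).exists_le
      -- An odd index below all the thresholds `N W`.
      have hodd : Odd (-(2 * |M|) - 1) := (even_two_mul _).neg.sub_odd odd_one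
      refine ⟨-(2 * |M|) - 1, (n, -2 * n), ⟨_, clusterHom_chebDelta hodd n, ?_⟩,
        fun W hW hne => ?_⟩
      · rw [chebDelta_coeff_ray hn, if_pos rfl]
      · have h2 := hM (-N ⟨W, hW⟩) (Finset.mem_image_of_mem _ (Finset.mem_univ _))
        have h3 := le_abs_self M
        have h4 := abs_nonneg M
        obtain ⟨f, hf, h5⟩ := hN ⟨W, hW⟩ _ (by linarith) hodd
        exact ⟨f, hf, h5.resolve_right hne⟩

/-- Every coefficient with respect to `𝓑` is a coefficient of a Laurent expansion. -/
lemma exists_coeff_eq (c : basisB →₀ QRing) (Z : basisB) : ∃ (m : ℤ) (f : QTorus) (e : ℤ × ℤ),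
    clusterHom m f = (c.sum fun W r => r • (W : QFrac)) ∧ f.coeff e = c Z := by
  classical
  obtain ⟨m, e, ⟨f, hf, hfe⟩, h⟩ := exists_separating Z.2 (c.support.image Subtype.val) (by
    intro W hW
    obtain ⟨W, -, rfl⟩ := Finset.mem_image.mp hW
    exact W.2)
  have h1 : ∀ W : basisB, ∃ g, W ∈ c.support →
      clusterHom m g = W ∧ g.coeff e = if W = Z then 1 else 0 := by
    intro W
    by_cases hW : W ∈ c.support
    · by_cases hWZ : W = Z
      · exact ⟨f, fun _ => by rw [if_pos hWZ, hWZ]; exact ⟨hf, hfe⟩⟩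
      · obtain ⟨g, hg, hge⟩ := h W (Finset.mem_image_of_mem _ hW) fun h => hWZ (Subtype.ext h)
        exact ⟨g, fun _ => by rw [if_neg hWZ]; exact ⟨hg, hge⟩⟩
    · exact ⟨0, fun h => absurd h hW⟩
  choose g hg using h1
  refine ⟨m, ∑ W ∈ c.support, c W • g W, e, ?_, ?_⟩
  · rw [map_sum]
    refine Finset.sum_congr rfl fun W hW => ?_
    rw [map_smul, (hg W hW).1]
  · rw [coeff_sum]
    have h2 : ∀ W ∈ c.support, (c W • g W).coeff e = if W = Z then c W else 0 := by
      intro W hW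
      rw [coeff_smul, (hg W hW).2, mul_ite, mul_one, mul_zero]
    rw [Finset.sum_congr rfl h2, Finset.sum_ite_eq' c.support Z]
    split_ifs with h3
    · rfl
    · exact (Finsupp.notMem_support_iff.mp h3).symm

theorem linearIndependent_basisB :
    LinearIndependent QRing (Subtype.val : basisB → QFrac) := by
  rw [linearIndependent_iff]
  intro c hc
  ext1 Z
  obtain ⟨m, f, e, hf, hfe⟩ := exists_coeff_eq c Z
  rw [Finsupp.linearCombination_apply] at hc
  have h0 : f = 0 := clusterHom_injective m (hf.trans (hc.trans (map_zero _).symm))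
  rw [← hfe, h0]
  rfl

lemma clusterHom_sum (m : ℤ) (c : ℤ × ℤ →₀ QRing) :
    clusterHom m (show QTorus from c) = c.sum fun e r => r • clusterMono m e.1 e.2 :=
  Finsupp.linearCombination_apply QRing c

/-- By injectivity of `clusterHom m`, the expansion whose coefficient at `e` is `c Z` coincides with
the non-negative expansion given by positivity. -/
theorem exists_nonneg_of_isPositive {Y : QFrac} (hY : IsPositive Y) :
    ∃ c : basisB →₀ QRing, (∀ Z, IsNonneg (c Z)) ∧ Y = c.sum fun Z r => r • (Z : QFrac) := by
  have h1 : Y ∈ Submodule.span QRing basisB := span_basisB ▸ hY.1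
  obtain ⟨c, hc⟩ := (Finsupp.mem_span_iff_linearCombination QRing basisB Y).mp h1
  rw [Finsupp.linearCombination_apply] at hc
  refine ⟨c, fun Z => ?_, hc.symm⟩
  obtain ⟨m, f, e, hf, hfe⟩ := exists_coeff_eq c Z
  obtain ⟨c', hc', hY'⟩ := hY.2 m
  have h2 : f = (show QTorus from c') :=
    clusterHom_injective m (hf.trans (hc.trans (hY'.trans (clusterHom_sum m c').symm)))
  rw [← hfe, h2]
  exact hc' e

end QCluster

end

theorem mainTheorem4 : QCluster.IsCanonicalBasis QCluster.basisB :=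
  ⟨⟨QCluster.linearIndependent_basisB, QCluster.span_basisB⟩,
    fun _ => QCluster.exists_nonneg_of_isPositive⟩
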